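/- **Setting.** Let $\mathcal X$ be a finite set whose elements are encoded injectively as bit strings, $\mathcal X\hookrightarrow\{0,1\}^n$ (for instance $\mathcal X=\{0,1\}^n$). A tuple in $\mathcal X^k$ is encoded by concatenation in $\{0,1\}^{kn}$, and circuits act on elements through their encodings. Circuits are Boolean circuits with gates $\neg,\wedge,\vee$ of fan-in at most two, with the input bits and the constants $0,1$ available as free sources; the size is the number of gates, and "a circuit of size $s$" means one with at most $s$ gates. Random variables are identified with their distributions, and $X^{\otimes k}$ denotes $k$ independent samples from $X$. Random variables $X,Y$ over a finite set $\mathcal Y$ are *$d$-indistinguishable by circuits of size $s$* if $$\Bigl|\sum_{y\in\mathcal Y} f(y)\bigl(\Pr[X=y]-\Pr[Y=y]\bigr)\Bigr|\le d$$ for every $f:\mathcal Y\to\{0,1\}$ computed by a circuit of size $s$, and *$d$-distinguishable by circuits of size $s$* if for some such $f$ the left-hand side is at least $d$. The Hellinger distance is $d_H(X,Y)=\bigl(\tfrac12\sum_{x\in\mathcal X}(\sqrt{\Pr[X=x]}-\sqrt{\Pr[Y=x]})^2\bigr)^{1/2}$. For $s\in\mathbb N$ and $\varepsilon>0$, the *$(s,\varepsilon)$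 pseudo-Hellinger distance* between $X_0$ and $X_1$ is the smallest $\delta$ for which there are random variables $\widetilde X_0,\widetilde X_1$ over $\mathcal X$ such that, for $b=0,1$, $X_b$ and $\widetilde X_b$ are $\varepsilon$-indistinguishable by circuits of size $s$, and $d_H(\widetilde X_0,\widetilde X_1)\le\delta$. **Theorem.** There are a constant $C$ and a real polynomial $P$ such that the following holds for all $\mathcal X$, $n$ and encodings as above, all random variables $X_0,X_1$ over $\mathcal X$, all $s\in\mathbb N$ and all $\varepsilon>0$. Let $\delta$ be the $(s,\varepsilon)$ pseudo-Hellinger distance between $X_0$ and $X_1$. (A) For every $k\in\mathbb N$: 1. $X_0^{\otimes k}$ and $X_1^{\otimes k}$ are $\bigl(\sqrt{2k\delta^2}+2k\varepsilon\bigr)$-indistinguishable by circuits of size $s$. 2. $X_0^{\otimes k}$ and $X_1^{\otimes k}$ are $\bigl(1-e^{-k\delta^2}-2k\varepsilon\bigr)$-distinguishable by circuits of some size $s'\le C\,sk/\varepsilon^6+P(k/\varepsilon)$. (B) $\Theta(1/\delta^2)$ samples are necessary and sufficient for constant advantage. Precisely, for every $a\in(0,1)$ there are constants $c_0,c_1,c_2>0$,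 depending only on $a$, such that: 1. (necessity) for every $k\in\mathbb N$ with $k\varepsilon\le c_0$, if $X_0^{\otimes k}$ and $X_1^{\otimes k}$ are $a$-distinguishable by circuits of size $s$, then $k\delta^2\ge c_1$; 2. (sufficiency) if $\varepsilon\le c_0\delta^2$, then for every $k\in\mathbb N$ with $k\delta^2\ge c_2$, $X_0^{\otimes k}$ and $X_1^{\otimes k}$ are $a$-distinguishable by circuits of some size $s'\le C\,sk/\varepsilon^6+P(k/\varepsilon)$. -/

import Mathlib

universe u

/-! ### Boolean circuits

Circuits over the basis `{¬, ∧, ∨}` with fan-in at most two, written as straight-line programs.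
The sources (input bits and the constants) are free; the size is the number of gates. -/

/-- A wire of a circuit that has input bits indexed by `ι` and `m` gates so far. -/
inductive Wire (ι : Type) (m : ℕ) : Type
  | const (b : Bool) : Wire ι m
  | input (i : ι) : Wire ι m
  | gate (j : Fin m) : Wire ι m

/-- A gate that reads wires of a circuit with `m` earlier gates. -/
inductive Gate (ι : Type) (m : ℕ) : Type
  | not (a : Wire ι m) : Gate ι m
  | and (a b : Wire ι m) : Gate ι m
  | or (a b : Wire ι m) : Gate ι m

/-- A sequence of `m` gates, each reading only sources and earlier gates. -/
inductive GateSeq (ι : Type) : ℕ → Type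
  | nil : GateSeq ι 0
  | snoc {m : ℕ} (G : GateSeq ι m) (g : Gate ι m) : GateSeq ι (m + 1)

/-- A Boolean circuit with one output bit. -/
structure Circuit (ι : Type) where
  size : ℕ
  gates : GateSeq ι size
  output : Wire ι size

/-- The value of a wire on input `x`, given the values `v` of the gates. -/
def Wire.eval {ι : Type} {m : ℕ} (x : ι → Bool) (v : Fin m → Bool) : Wire ι m → Bool
  | .const b => b
  | .input i => x i
  | .gate j => v j

/-- The value of a gate on input `x`, given the values `v` of the earlier gates. -/
def Gate.eval {ι : Type} {m : ℕ} (x : ι → Bool) (v : Fin m → Bool) : Gate ι m → Bool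
  | .not a => !(a.eval x v)
  | .and a b => a.eval x v && b.eval x v
  | .or a b => a.eval x v || b.eval x v

/-- The values of all gates on input `x`. -/
def GateSeq.eval {ι : Type} (x : ι → Bool) : {m : ℕ} → GateSeq ι m → Fin m → Bool
  | _, .nil => Fin.elim0
  | _, .snoc G g => Fin.snoc (α := fun _ => Bool) (G.eval x) (g.eval x (G.eval x))

/-- The output of a circuit on input `x`. -/
def Circuit.eval {ι : Type} (c : Circuit ι) (x : ι → Bool) : Bool :=
  c.output.eval x (c.gates.eval x)

/-! ### Computational indistinguishability

Probability distributions on a finite set are `PMF`s. A circuit acts on a finite set `𝒴` through an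
encoding `e : 𝒴 → (ι → Bool)` of its elements by bit strings. -/

/-- The advantage `|∑ y, f y * (ℙ[X = y] - ℙ[Y = y])|` of the Boolean test `f`. -/
noncomputable def advantage {𝒴 : Type u} [Fintype 𝒴] (X Y : PMF 𝒴) (f : 𝒴 → Bool) : ℝ :=
  |∑ y, (if f y then (1 : ℝ) else 0) * ((X y).toReal - (Y y).toReal)|

/-- `X` and `Y` are `d`-indistinguishable by circuits of size `s`. -/
def Indistinguishable {𝒴 : Type u} [Fintype 𝒴] {ι : Type} (e : 𝒴 → ι → Bool) (s : ℕ) (d : ℝ)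
    (X Y : PMF 𝒴) : Prop :=
  ∀ c : Circuit ι, c.size ≤ s → advantage X Y (fun y => c.eval (e y)) ≤ d

/-- `X` and `Y` are `d`-distinguishable by circuits of size `s`: some such circuit has advantage at
least `d`. -/
def Distinguishable {𝒴 : Type u} [Fintype 𝒴] {ι : Type} (e : 𝒴 → ι → Bool) (s : ℕ) (d : ℝ)
    (X Y : PMF 𝒴) : Prop :=
  ∃ c : Circuit ι, c.size ≤ s ∧ d ≤ advantage X Y (fun y => c.eval (e y))

/-- The distribution `X^{⊗k}` of `k` independent samples from `X`. -/
noncomputable def iidPMF {𝒳 : Type u} [Fintype 𝒳] (X : PMF 𝒳) (k : ℕ) : PMF (Fin k → 𝒳) :=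
  PMF.ofFintype (fun x => ∏ i, X (x i)) (by
    have h := Finset.prod_univ_sum (fun _ : Fin k => (Finset.univ : Finset 𝒳)) (fun _ y => X y)
    rw [Fintype.piFinset_univ] at h
    rw [← h]
    have h1 : ∑ y, X y = 1 := by rw [← tsum_fintype (L := .unconditional _)]; exact X.tsum_coe
    simp [h1])

/-- The encoding of a `k`-tuple of samples: the concatenation of the encodings of the samples. -/
def encTuple {𝒳 : Type u} {n : ℕ} (e : 𝒳 → Fin n → Bool) (k : ℕ) :
    (Fin k → 𝒳) → Fin k × Fin n → Bool :=
  fun x p => e (x p.1) p.2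

/-! ### Pseudo-Hellinger distance -/

/-- The Hellinger distance, `d_H(X, Y)² = (1/2) ∑ (√ℙ[X = x] - √ℙ[Y = x])²`. -/
noncomputable def hellingerDist {𝒳 : Type u} [Fintype 𝒳] (X Y : PMF 𝒳) : ℝ :=
  Real.sqrt ((1 / 2) * ∑ x, (Real.sqrt (X x).toReal - Real.sqrt (Y x).toReal) ^ 2)

/-- `δ` is the `(s, ε)` pseudo-Hellinger distance between `X₀` and `X₁`: the smallest `δ` such that
there are `Y₀`, `Y₁`, `ε`-indistinguishable from `X₀`, `X₁` respectively by circuits of size `s`,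
with `d_H(Y₀, Y₁) ≤ δ`. -/
def IsPseudoHellingerDist {𝒳 : Type u} [Fintype 𝒳] {n : ℕ} (e : 𝒳 → Fin n → Bool) (s : ℕ) (ε : ℝ)
    (X₀ X₁ : PMF 𝒳) (δ : ℝ) : Prop :=
  IsLeast {d : ℝ | ∃ Y₀ Y₁ : PMF 𝒳, Indistinguishable e s ε X₀ Y₀ ∧
    Indistinguishable e s ε X₁ Y₁ ∧ hellingerDist Y₀ Y₁ ≤ d} δ

/-- The smallest `δ` exists, so that the pseudo-Hellinger distance is well defined. -/
theorem exists_isPseudoHellingerDist {𝒳 : Type u} [Fintype 𝒳] {n : ℕ} (e : 𝒳 → Fin n → Bool)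
    (s : ℕ) {ε : ℝ} (hε : 0 < ε) (X₀ X₁ : PMF 𝒳) :
    ∃ δ, IsPseudoHellingerDist e s ε X₀ X₁ δ := by
  classical
  let adv : (𝒳 → ℝ) → (𝒳 → ℝ) → (𝒳 → Bool) → ℝ := fun p q f =>
    |∑ y, (if f y then (1 : ℝ) else 0) * (p y - q y)|
  let v : PMF 𝒳 → 𝒳 → ℝ := fun X x => (X x).toReal
  let K : PMF 𝒳 → Set (𝒳 → ℝ) := fun X => stdSimplex ℝ 𝒳 ∩
    ⋂ c : Circuit (Fin n), {q | c.size ≤ s → adv (v X) q (fun y => c.eval (e y)) ≤ ε}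
  have hK : ∀ X, IsCompact (K X) := by
    intro X
    refine (isCompact_stdSimplex ℝ 𝒳).inter_right (isClosed_iInter fun c => ?_)
    by_cases hc : c.size ≤ s
    · simp only [hc, true_imp_iff]
      exact isClosed_le (by fun_prop) continuous_const
    · simp [hc]
  have hv : ∀ X : PMF 𝒳, v X ∈ stdSimplex ℝ 𝒳 := by
    intro X
    refine ⟨fun x => ENNReal.toReal_nonneg, ?_⟩
    have h1 : ∑ y, X y = 1 := by rw [← tsum_fintype (L := .unconditional _)]; exact X.tsum_coe
    rw [← ENNReal.toReal_sum (fun x _ => X.apply_ne_top x), h1, ENNReal.toReal_one]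
  have hKv : ∀ X, v X ∈ K X := fun X => ⟨hv X, by
    refine Set.mem_iInter.2 ?_
    intro c _
    simp [adv, hε.le]⟩
  have hrep : ∀ q ∈ stdSimplex ℝ 𝒳, ∃ Y : PMF 𝒳, v Y = q := by
    intro q hq
    refine ⟨PMF.ofFintype (fun x => ENNReal.ofReal (q x)) ?_, ?_⟩
    · rw [← ENNReal.ofReal_sum_of_nonneg (fun x _ => hq.1 x), hq.2, ENNReal.ofReal_one]
    · funext x
      simp [v, PMF.ofFintype_apply, ENNReal.toReal_ofReal (hq.1 x)]
  let H : (𝒳 → ℝ) × (𝒳 → ℝ) → ℝ := fun r =>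
    Real.sqrt ((1 / 2) * ∑ x, (Real.sqrt (r.1 x) - Real.sqrt (r.2 x)) ^ 2)
  have hH : Continuous H := by
    simp only [H]
    fun_prop
  obtain ⟨⟨q₀, q₁⟩, ⟨h₀, h₁⟩, hmin⟩ := ((hK X₀).prod (hK X₁)).exists_isMinOn
    ⟨(v X₀, v X₁), hKv X₀, hKv X₁⟩ hH.continuousOn
  obtain ⟨Y₀, rfl⟩ := hrep q₀ h₀.1
  obtain ⟨Y₁, rfl⟩ := hrep q₁ h₁.1
  refine ⟨hellingerDist Y₀ Y₁, ⟨Y₀, Y₁, ?_, ?_, le_rfl⟩, ?_⟩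
  · exact fun c hc => Set.mem_iInter.1 h₀.2 c hc
  · exact fun c hc => Set.mem_iInter.1 h₁.2 c hc
  · rintro d ⟨Z₀, Z₁, hZ₀, hZ₁, hd⟩
    refine le_trans ?_ hd
    exact hmin (show (v Z₀, v Z₁) ∈ K X₀ ×ˢ K X₁ from
      ⟨⟨hv Z₀, Set.mem_iInter.2 fun c hc => hZ₀ c hc⟩,
        ⟨hv Z₁, Set.mem_iInter.2 fun c hc => hZ₁ c hc⟩⟩)

/-!
The upper bound on the advantage is a hybrid argument (`abs_iidExp_sub_le`): all samples but one can
be hard-wired into a circuit at no cost, so `k` samples from `X_b` may be replaced by `k` samples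
from a minimizer of the pseudo-Hellinger distance with error `kε`. For the minimizers the bound is
the classical one, total variation being at most `√2` times the Hellinger distance, whose square is
subadditive over independent samples (`abs_iidExp_sub_le_sqrt`).

For the lower bound let `w = X₀ + X₁` and regard `g = X₁ / w` as an unknown function to be
predicted. `exists_calibrated` produces, by boosting on the squared loss, a function `S` with
`O(1 / ε²)` values such that averaging `g` over the level sets of `S` gives a predictor `u` that no
circuit of size `s` tells from `g`. While a circuit does, a finite-state update (add a multiple of
the circuit's output, clip, round to a grid) decreases the loss by `ε² / 4`, so `O(1 / ε²)` updates
suffice, and `S` is computed by running through these states in one-hot encoding. The weights `w u`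
and `w (1 - u)` are then admissible in the definition of the pseudo-Hellinger distance, so that
their Hellinger distance is at least `δ`. Their likelihood ratio `u / (1 - u)` depends on `S` only,
and functions of `S` have the same expectation under `X₁` and `w u`, and under `X₀` and
`w (1 - u)`. So the likelihood-ratio test on `k` samples of the calibrated weights, whose advantage
is at least `1 - (1 - δ²)^k`, has the same advantage on `X₀`, `X₁`. The error `2kε` pays for
smoothing and rounding the log-likelihood ratios (`le_iidExp_ratioScore_test`), which turns the test
into the sign of a sum of `k` integers of size `O(1 / ε²)`, computed again by a finite-state circuit
(`exists_circuit_sum_nonneg`).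

A constant advantage is obtained by applying the lower bound to the first `⌈c / δ²⌉` samples only,
as the error `2kε` would otherwise grow with `k`.
-/

/-! ### Composition of circuits -/

/-- Transport a wire along a reinterpretation `σ` of the inputs and `φ` of the gates. -/
def Wire.map {ι κ : Type} {m m' : ℕ} (σ : ι → Wire κ m') (φ : Fin m → Fin m') :
    Wire ι m → Wire κ m'
  | .const b => .const b
  | .input i => σ i
  | .gate j => .gate (φ j)

/-- Transport a gate along a reinterpretation of the inputs and of the earlier gates. -/
def Gate.map {ι κ : Type} {m m' : ℕ} (σ : ι → Wire κ m') (φ : Fin m → Fin m') :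
    Gate ι m → Gate κ m'
  | .not a => .not (a.map σ φ)
  | .and a b => .and (a.map σ φ) (b.map σ φ)
  | .or a b => .or (a.map σ φ) (b.map σ φ)

theorem Wire.eval_map {ι κ : Type} {m m' : ℕ} {σ : ι → Wire κ m'} {φ : Fin m → Fin m'}
    {x : ι → Bool} {y : κ → Bool} {v : Fin m → Bool} {v' : Fin m' → Bool}
    (hσ : ∀ i, (σ i).eval y v' = x i) (hφ : ∀ j, v' (φ j) = v j) (a : Wire ι m) :
    (a.map σ φ).eval y v' = a.eval x v := by
  cases a with
  | const b => rfl
  | input i => exact hσ i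
  | gate j => exact hφ j

theorem Gate.eval_map {ι κ : Type} {m m' : ℕ} {σ : ι → Wire κ m'} {φ : Fin m → Fin m'}
    {x : ι → Bool} {y : κ → Bool} {v : Fin m → Bool} {v' : Fin m' → Bool}
    (hσ : ∀ i, (σ i).eval y v' = x i) (hφ : ∀ j, v' (φ j) = v j) (g : Gate ι m) :
    (g.map σ φ).eval y v' = g.eval x v := by
  cases g <;> simp only [Gate.map, Gate.eval, Wire.eval_map hσ hφ]

/-- Regard a wire of a circuit with `m` gates as a wire after `j` more gates. -/
def Wire.lift {ι : Type} {m : ℕ} (j : ℕ) (a : Wire ι m) : Wire ι (m + j) :=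
  a.map Wire.input (Fin.castAdd j)

theorem Wire.eval_lift {ι : Type} {m j : ℕ} {x : ι → Bool} {v : Fin m → Bool}
    {v' : Fin (m + j) → Bool} (h : ∀ i, v' (Fin.castAdd j i) = v i) (a : Wire ι m) :
    (a.lift j).eval x v' = a.eval x v :=
  Wire.eval_map (fun _ => rfl) h a

/-- Run `G`, then run `H` with its inputs read off the wires `σ` of `G`. -/
def GateSeq.comp {ι κ : Type} {m : ℕ} (G : GateSeq κ m) (σ : ι → Wire κ m) :
    {j : ℕ} → GateSeq ι j → GateSeq κ (m + j)
  | _, .nil => G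
  | j + 1, .snoc H g =>
      .snoc (G.comp σ H) (g.map (fun i => (σ i).lift j) (Fin.natAdd m))

theorem GateSeq.eval_comp {ι κ : Type} {m : ℕ} (G : GateSeq κ m) (σ : ι → Wire κ m)
    (y : κ → Bool) {j : ℕ} (H : GateSeq ι j) :
    (∀ i, (G.comp σ H).eval y (Fin.castAdd j i) = G.eval y i) ∧
      ∀ i, (G.comp σ H).eval y (Fin.natAdd m i) =
        H.eval (fun i => (σ i).eval y (G.eval y)) i := by
  induction H with
  | nil => exact ⟨fun i => rfl, fun i => i.elim0⟩
  | @snoc j H g ih =>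
    obtain ⟨ih1, ih2⟩ := ih
    have hg := Gate.eval_map (σ := fun i => (σ i).lift j) (φ := Fin.natAdd m)
      (x := fun i => (σ i).eval y (G.eval y)) (y := y)
      (fun i => Wire.eval_lift ih1 (σ i)) ih2 g
    constructor
    · intro i
      rw [← ih1 i]
      exact Fin.snoc_castSucc (α := fun _ => Bool) _ _ (Fin.castAdd j i)
    · intro i
      refine Fin.lastCases ?_ (fun i => ?_) i
      · refine (Fin.snoc_last (α := fun _ => Bool) _ _).trans (hg.trans ?_)
        exact (Fin.snoc_last (α := fun _ => Bool) _ _).symm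
      · refine (Fin.snoc_castSucc (α := fun _ => Bool) _ _ (Fin.natAdd m i)).trans
          ((ih2 i).trans ?_)
        exact (Fin.snoc_castSucc (α := fun _ => Bool) _ _ i).symm

/-- Inputs of a circuit can be replaced by constants and by other inputs at no cost. -/
theorem Circuit.exists_subst {ι κ : Type} (c : Circuit ι) (σ : ι → Wire κ 0) :
    ∃ c' : Circuit κ, c'.size = c.size ∧
      ∀ y, c'.eval y = c.eval fun i => (σ i).eval y Fin.elim0 := by
  refine ⟨⟨0 + c.size, GateSeq.nil.comp σ c.gates,
    c.output.map (fun i => (σ i).lift c.size) (Fin.natAdd 0)⟩, Nat.zero_add _, fun y => ?_⟩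
  obtain ⟨h1, h2⟩ := GateSeq.eval_comp GateSeq.nil σ y c.gates
  exact Wire.eval_map (fun i => Wire.eval_lift h1 (σ i)) h2 c.output

/-! ### Families of Boolean functions computed together -/

/-- Some gate sequence with at most `N` gates carries each function of the family `F` on one of its
wires. -/
def JointlyComputed {ι : Type} (N : ℕ) (F : Set ((ι → Bool) → Bool)) : Prop :=
  ∃ m ≤ N, ∃ G : GateSeq ι m, ∀ f ∈ F, ∃ a : Wire ι m, ∀ x, a.eval x (G.eval x) = f x

namespace JointlyComputed

variable {ι κ : Type} {N M : ℕ} {F F' : Set ((ι → Bool) → Bool)}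

theorem mono (h : JointlyComputed N F) (hN : N ≤ M) (hF : F' ⊆ F) : JointlyComputed M F' := by
  obtain ⟨m, hm, G, hG⟩ := h
  exact ⟨m, hm.trans hN, G, fun f hf => hG f (hF hf)⟩

theorem union (h : JointlyComputed N F) (h' : JointlyComputed M F') :
    JointlyComputed (N + M) (F ∪ F') := by
  obtain ⟨m, hm, G, hG⟩ := h
  obtain ⟨m', hm', G', hG'⟩ := h'
  refine ⟨m + m', by omega, G.comp Wire.input G', ?_⟩
  rintro f (hf | hf)
  · obtain ⟨a, ha⟩ := hG f hf
    refine ⟨a.lift m', fun x => ?_⟩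
    rw [← ha x]
    exact Wire.eval_lift (GateSeq.eval_comp G Wire.input x G').1 a
  · obtain ⟨a, ha⟩ := hG' f hf
    refine ⟨a.map Wire.input (Fin.natAdd m), fun x => ?_⟩
    rw [← ha x]
    exact Wire.eval_map (fun _ => rfl) (GateSeq.eval_comp G Wire.input x G').2 a

/-- Adding one gate. -/
theorem insert_gate {f : (ι → Bool) → Bool} (h : JointlyComputed N F)
    (hf : ∀ {m : ℕ} (G : GateSeq ι m),
      (∀ f' ∈ F, ∃ a : Wire ι m, ∀ x, a.eval x (G.eval x) = f' x) →
        ∃ g : Gate ι m, ∀ x, g.eval x (G.eval x) = f x) :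
    JointlyComputed (N + 1) (insert f F) := by
  obtain ⟨m, hm, G, hG⟩ := h
  obtain ⟨g, hg⟩ := hf G hG
  refine ⟨m + 1, by omega, G.snoc g, ?_⟩
  rintro f' (rfl | hf')
  · exact ⟨.gate (Fin.last m), fun x => (Fin.snoc_last (α := fun _ => Bool) _ _).trans (hg x)⟩
  · obtain ⟨a, ha⟩ := hG f' hf'
    refine ⟨a.lift 1, fun x => ?_⟩
    rw [← ha x]
    exact Wire.eval_lift (fun i => Fin.snoc_castSucc (α := fun _ => Bool) _ _ i) a

theorem insert_not {f : (ι → Bool) → Bool} (h : JointlyComputed N F) (hf : f ∈ F) :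
    JointlyComputed (N + 1) (insert (fun x => !f x) F) :=
  h.insert_gate fun G hG => by
    obtain ⟨a, ha⟩ := hG f hf
    exact ⟨.not a, fun x => by simp [Gate.eval, ha]⟩

theorem insert_and {f g : (ι → Bool) → Bool} (h : JointlyComputed N F) (hf : f ∈ F)
    (hg : g ∈ F) : JointlyComputed (N + 1) (insert (fun x => f x && g x) F) :=
  h.insert_gate fun G hG => by
    obtain ⟨a, ha⟩ := hG f hf
    obtain ⟨b, hb⟩ := hG g hg
    exact ⟨.and a b, fun x => by simp [Gate.eval, ha, hb]⟩

theorem insert_or {f g : (ι → Bool) → Bool} (h : JointlyComputed N F) (hf : f ∈ F)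
    (hg : g ∈ F) : JointlyComputed (N + 1) (insert (fun x => f x || g x) F) :=
  h.insert_gate fun G hG => by
    obtain ⟨a, ha⟩ := hG f hf
    obtain ⟨b, hb⟩ := hG g hg
    exact ⟨.or a b, fun x => by simp [Gate.eval, ha, hb]⟩

theorem insert_const (h : JointlyComputed N F) (b : Bool) :
    JointlyComputed N (insert (fun _ => b) F) := by
  obtain ⟨m, hm, G, hG⟩ := h
  refine ⟨m, hm, G, ?_⟩
  rintro f' (rfl | hf')
  · exact ⟨.const b, fun x => rfl⟩
  · exact hG f' hf'

/-- A disjunction of `L.length` conjunctions of two functions takes `2 * L.length` gates. -/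
theorem insert_any (h : JointlyComputed N F)
    (L : List (((ι → Bool) → Bool) × ((ι → Bool) → Bool)))
    (hL : ∀ p ∈ L, p.1 ∈ F ∧ p.2 ∈ F) :
    JointlyComputed (N + 2 * L.length) (insert (fun x => L.any fun p => p.1 x && p.2 x) F) := by
  induction L with
  | nil => simpa using h.insert_const false
  | cons p L ih =>
    have hp := hL p (by simp)
    have h1 := ih fun q hq => hL q (by simp [hq])
    have h2 := h1.insert_and (Set.mem_insert_of_mem _ hp.1) (Set.mem_insert_of_mem _ hp.2)
    have h3 := h2.insert_or (Set.mem_insert _ _) (Set.mem_insert_of_mem _ (Set.mem_insert _ _))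
    refine h3.mono (by simp only [List.length_cons]; omega) ?_
    simp only [List.any_cons]
    exact Set.insert_subset_insert
      ((Set.subset_insert _ _).trans (Set.subset_insert _ _))

/-- If every function of a finite family costs `ℓ` additional gates, `r` of them cost `r * ℓ`. -/
theorem union_image {D : Type*} [DecidableEq D] {ℓ : ℕ} (h : JointlyComputed N F)
    (g : D → (ι → Bool) → Bool)
    (hg : ∀ (d : D) (N' : ℕ) (F' : Set ((ι → Bool) → Bool)), F ⊆ F' → JointlyComputed N' F' →
      JointlyComputed (N' + ℓ) (insert (g d) F'))
    (t : Finset D) : JointlyComputed (N + t.card * ℓ) (F ∪ g '' t) := by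
  induction t using Finset.induction_on with
  | empty => simpa using h
  | insert d t hd ih =>
    refine (hg d _ _ Set.subset_union_left ih).mono ?_ ?_
    · rw [Finset.card_insert_of_notMem hd]
      linarith
    · rw [Finset.coe_insert, Set.image_insert_eq, Set.union_insert]

theorem of_circuit (c : Circuit ι) : JointlyComputed c.size {c.eval} :=
  ⟨c.size, le_rfl, c.gates, by rintro f rfl; exact ⟨c.output, fun x => rfl⟩⟩

theorem exists_circuit {f : (ι → Bool) → Bool} (h : JointlyComputed N {f}) :
    ∃ c : Circuit ι, c.size ≤ N ∧ c.eval = f := by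
  obtain ⟨m, hm, G, hG⟩ := h
  obtain ⟨a, ha⟩ := hG f rfl
  exact ⟨⟨m, G, a⟩, hm, funext ha⟩

theorem comp_input (φ : ι → κ) (h : JointlyComputed N F) :
    JointlyComputed N ((fun (f : (ι → Bool) → Bool) (y : κ → Bool) => f (y ∘ φ)) '' F) := by
  obtain ⟨m, hm, G, hG⟩ := h
  refine ⟨0 + m, by omega, GateSeq.nil.comp (fun i => .input (φ i)) G, ?_⟩
  rintro _ ⟨f, hf, rfl⟩
  obtain ⟨a, ha⟩ := hG f hf
  refine ⟨a.map (fun i => .input (φ i)) (Fin.natAdd 0), fun y => ?_⟩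
  exact (Wire.eval_map (fun _ => rfl)
    (GateSeq.eval_comp GateSeq.nil (fun i => .input (φ i)) y G).2 a).trans (ha (y ∘ φ))

end JointlyComputed

/-! ### Finite-state computations in one-hot encoding -/

/-- The `A`-valued function `S` of the input bits is computed by at most `N` gates in one-hot
encoding: for every value `a` some wire carries the indicator of `S x = a`. -/
def OneHotComputed {ι : Type} {A : Type*} [DecidableEq A] (N : ℕ) (S : (ι → Bool) → A) : Prop :=
  JointlyComputed N (Set.range fun (a : A) (x : ι → Bool) => decide (S x = a))

namespace OneHotComputed

variable {ι κ : Type} {A B D : Type*} [DecidableEq A] [DecidableEq B] [DecidableEq D] {N M : ℕ}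

theorem mono {S : (ι → Bool) → A} (h : OneHotComputed N S) (hN : N ≤ M) : OneHotComputed M S :=
  JointlyComputed.mono h hN subset_rfl

theorem const (a : A) : OneHotComputed 0 fun _ : ι → Bool => a :=
  ⟨0, le_rfl, .nil, by rintro _ ⟨b, rfl⟩; exact ⟨.const (decide (a = b)), fun x => rfl⟩⟩

theorem of_circuit (c : Circuit ι) : OneHotComputed (c.size + 1) c.eval := by
  refine ((JointlyComputed.of_circuit c).insert_not rfl).mono le_rfl ?_
  rintro _ ⟨b, rfl⟩
  cases b
  · left; funext x; simp
  · right; simp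

theorem comp_input {S : (ι → Bool) → A} (φ : ι → κ) (h : OneHotComputed N S) :
    OneHotComputed N fun y : κ → Bool => S (y ∘ φ) := by
  refine (JointlyComputed.comp_input φ h).mono le_rfl ?_
  rintro _ ⟨a, rfl⟩
  exact ⟨_, ⟨a, rfl⟩, rfl⟩

/-- The state `τ (S x) (R x)` is read off from `S x` and `R x` by a lookup table. -/
theorem combine [Fintype A] [Fintype B] [Fintype D] {S : (ι → Bool) → A} {R : (ι → Bool) → B}
    (hS : OneHotComputed N S) (hR : OneHotComputed M R) (τ : A → B → D) :
    OneHotComputed (N + M + 2 * (Fintype.card A * Fintype.card B * Fintype.card D))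
      fun x => τ (S x) (R x) := by
  have h := (JointlyComputed.union hS hR).union_image
    (ℓ := 2 * (Fintype.card A * Fintype.card B))
    (fun (d : D) (x : ι → Bool) => decide (τ (S x) (R x) = d)) ?_ Finset.univ
  · refine h.mono (le_of_eq ?_) ?_
    · rw [Finset.card_univ]; ring
    · rintro _ ⟨d, rfl⟩
      exact Or.inr ⟨d, by simp, rfl⟩
  · intro d N' F' hF h'
    let t : Finset (A × B) := Finset.univ.filter fun p => τ p.1 p.2 = d
    have ht : t.card ≤ Fintype.card A * Fintype.card B := by
      rw [← Fintype.card_prod]; exact Finset.card_le_univ t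
    have h2 := h'.insert_any (t.toList.map fun p =>
      (fun x => decide (S x = p.1), fun x => decide (R x = p.2))) ?_
    · refine h2.mono (by simpa using ht) ?_
      have heq : (fun x => decide (τ (S x) (R x) = d)) = fun x =>
          (t.toList.map fun p => ((fun x : ι → Bool => decide (S x = p.1)),
            (fun x : ι → Bool => decide (R x = p.2)))).any fun p => p.1 x && p.2 x := by
        funext x
        rw [Bool.eq_iff_iff]
        simp [t]
      rw [heq]
    · intro q hq
      obtain ⟨p, -, rfl⟩ := List.mem_map.1 hq
      exact ⟨hF (Or.inl ⟨p.1, rfl⟩), hF (Or.inr ⟨p.2, rfl⟩)⟩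

end OneHotComputed

/-! ### Expectations over independent samples -/

/-- The expectation of `F` over `k` independent samples from the weight function `p`. -/
noncomputable def iidExp {𝒳 : Type u} [Fintype 𝒳] (p : 𝒳 → ℝ) (k : ℕ) (F : (Fin k → 𝒳) → ℝ) : ℝ :=
  ∑ x, (∏ i, p (x i)) * F x

section iidExp

variable {𝒳 : Type u} [Fintype 𝒳] {p q : 𝒳 → ℝ}

theorem iidExp_succ (p : 𝒳 → ℝ) (k : ℕ) (F : (Fin (k + 1) → 𝒳) → ℝ) :
    iidExp p (k + 1) F = ∑ a, p a * iidExp p k fun x => F (Fin.cons a x) := by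
  unfold iidExp
  rw [← (Fin.consEquiv fun _ : Fin (k + 1) => 𝒳).sum_comp, Fintype.sum_prod_type]
  refine Finset.sum_congr rfl fun a _ => ?_
  rw [Finset.mul_sum]
  refine Finset.sum_congr rfl fun x _ => ?_
  simp [Fin.consEquiv, Fin.prod_univ_succ, mul_assoc]

theorem sum_prod_eq_pow (p : 𝒳 → ℝ) (k : ℕ) : ∑ x : Fin k → 𝒳, ∏ i, p (x i) = (∑ a, p a) ^ k := by
  have h := Finset.prod_univ_sum (fun _ : Fin k => (Finset.univ : Finset 𝒳)) (fun _ y => p y)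
  rw [Fintype.piFinset_univ] at h
  simp [← h]

theorem iidExp_const (hp : ∑ a, p a = 1) (k : ℕ) (c : ℝ) : iidExp p k (fun _ => c) = c := by
  rw [iidExp, ← Finset.sum_mul, sum_prod_eq_pow, hp, one_pow, one_mul]

/-- A test that ignores the samples from `k` on. -/
theorem iidExp_castLE (hp : ∑ a, p a = 1) {k : ℕ} (F : (Fin k → 𝒳) → ℝ) {l : ℕ} (h : k ≤ l) :
    iidExp p l (fun x => F fun i => x (Fin.castLE h i)) = iidExp p k F := by
  induction k generalizing l with
  | zero =>
    have hF : F = fun _ => F Fin.elim0 := funext fun x => congrArg F (Subsingleton.elim _ _)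
    rw [hF, iidExp_const hp, iidExp_const hp]
  | succ k ih =>
    obtain ⟨l, rfl⟩ : ∃ l', l = l' + 1 := ⟨l - 1, by omega⟩
    rw [iidExp_succ, iidExp_succ]
    refine Finset.sum_congr rfl fun a _ => ?_
    rw [← ih (fun x => F (Fin.cons a x)) (Nat.le_of_succ_le_succ h)]
    congr 2
    funext x
    congr 1
    funext i
    refine Fin.cases rfl (fun i => ?_) i
    rw [Fin.cons_succ]
    exact Fin.cons_succ (α := fun _ => 𝒳) a x (Fin.castLE (Nat.le_of_succ_le_succ h) i)

/-- Hybrid argument: if replacing `p` by `q` in a single sample, the other samples being fixed,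
changes the expectation by at most `c`, then replacing it in all `k` samples changes it by at most
`k * c`. -/
theorem abs_iidExp_sub_le (hp : ∀ a, 0 ≤ p a) (hp1 : ∑ a, p a = 1) (hq : ∀ a, 0 ≤ q a)
    (hq1 : ∑ a, q a = 1) {c : ℝ} {k : ℕ} (F : (Fin k → 𝒳) → ℝ)
    (h : ∀ i x, |∑ a, (p a - q a) * F (Function.update x i a)| ≤ c) :
    |iidExp p k F - iidExp q k F| ≤ k * c := by
  induction k with
  | zero => simp [iidExp]
  | succ k ih =>
    have hne : Nonempty 𝒳 := by
      by_contra hne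
      rw [not_nonempty_iff] at hne
      simp at hp1
    obtain ⟨b⟩ := hne
    have h1 : ∀ a, |iidExp p k (fun x => F (Fin.cons a x)) - iidExp q k fun x => F (Fin.cons a x)|
        ≤ k * c := fun a => ih _ fun i x => by
      simpa only [Fin.cons_update] using h i.succ (Fin.cons a x)
    have h2 : ∀ x : Fin k → 𝒳, |∑ a, (p a - q a) * F (Fin.cons a x)| ≤ c := fun x => by
      simpa only [Fin.update_cons_zero] using h 0 (Fin.cons b x)
    have hsplit : iidExp p (k + 1) F - iidExp q (k + 1) F =
        ∑ a, p a * (iidExp p k (fun x => F (Fin.cons a x)) - iidExp q k fun x => F (Fin.cons a x))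
        + ∑ x : Fin k → 𝒳, (∏ i, q (x i)) * ∑ a, (p a - q a) * F (Fin.cons a x) := by
      have hswap : ∑ x : Fin k → 𝒳, (∏ i, q (x i)) * ∑ a, (p a - q a) * F (Fin.cons a x) =
          ∑ a, (p a - q a) * iidExp q k fun x => F (Fin.cons a x) := by
        simp only [iidExp, Finset.mul_sum]
        rw [Finset.sum_comm]
        exact Finset.sum_congr rfl fun a _ => Finset.sum_congr rfl fun x _ => by ring
      rw [hswap, iidExp_succ, iidExp_succ, ← Finset.sum_sub_distrib, ← Finset.sum_add_distrib]
      exact Finset.sum_congr rfl fun a _ => by ring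
    rw [hsplit]
    have e1 : |∑ a, p a * (iidExp p k (fun x => F (Fin.cons a x)) -
        iidExp q k fun x => F (Fin.cons a x))| ≤ k * c := by
      refine (Finset.abs_sum_le_sum_abs _ _).trans ?_
      calc _ ≤ ∑ a, p a * (k * c) := Finset.sum_le_sum fun a _ => by
            rw [abs_mul, abs_of_nonneg (hp a)]
            exact mul_le_mul_of_nonneg_left (h1 a) (hp a)
        _ = k * c := by rw [← Finset.sum_mul, hp1, one_mul]
    have e2 : |∑ x : Fin k → 𝒳, (∏ i, q (x i)) * ∑ a, (p a - q a) * F (Fin.cons a x)| ≤ c := by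
      refine (Finset.abs_sum_le_sum_abs _ _).trans ?_
      calc _ ≤ ∑ x : Fin k → 𝒳, (∏ i, q (x i)) * c := Finset.sum_le_sum fun x _ => by
            have := Finset.prod_nonneg fun i (_ : i ∈ Finset.univ) => hq (x i)
            rw [abs_mul, abs_of_nonneg this]
            exact mul_le_mul_of_nonneg_left (h2 x) this
        _ = c := by rw [← Finset.sum_mul, sum_prod_eq_pow, hq1, one_pow, one_mul]
    refine (abs_add_le _ _).trans ?_
    push_cast
    linarith

end iidExp

/-! ### Probability mass functions as real weights -/

section Weights

variable {𝒳 : Type u} [Fintype 𝒳]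

theorem PMF.sum_toReal_eq_one (X : PMF 𝒳) : ∑ x, (X x).toReal = 1 := by
  have h1 : ∑ y, X y = 1 := by rw [← tsum_fintype (L := .unconditional _)]; exact X.tsum_coe
  rw [← ENNReal.toReal_sum (fun x _ => X.apply_ne_top x), h1, ENNReal.toReal_one]

theorem PMF.exists_toReal_eq {p : 𝒳 → ℝ} (hp : ∀ x, 0 ≤ p x) (hp1 : ∑ x, p x = 1) :
    ∃ X : PMF 𝒳, ∀ x, (X x).toReal = p x := by
  refine ⟨PMF.ofFintype (fun x => ENNReal.ofReal (p x)) ?_, fun x => ?_⟩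
  · rw [← ENNReal.ofReal_sum_of_nonneg (fun x _ => hp x), hp1, ENNReal.ofReal_one]
  · simp [PMF.ofFintype_apply, ENNReal.toReal_ofReal (hp x)]

theorem advantage_iidPMF (X Y : PMF 𝒳) (k : ℕ) (f : (Fin k → 𝒳) → Bool) :
    advantage (iidPMF X k) (iidPMF Y k) f =
      |iidExp (fun x => (X x).toReal) k (fun x => if f x then 1 else 0) -
        iidExp (fun x => (Y x).toReal) k (fun x => if f x then 1 else 0)| := by
  unfold advantage iidExp
  rw [← Finset.sum_sub_distrib]
  congr 1
  refine Finset.sum_congr rfl fun x _ => ?_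
  simp only [iidPMF, PMF.ofFintype_apply, ENNReal.toReal_prod]
  ring

end Weights

/-! ### Hellinger distance and total variation -/

section Hellinger

variable {𝒳 : Type u} [Fintype 𝒳]

theorem sum_sq_sqrt_sub {P Q : 𝒳 → ℝ} (hP : ∀ x, 0 ≤ P x) (hQ : ∀ x, 0 ≤ Q x)
    (hP1 : ∑ x, P x = 1) (hQ1 : ∑ x, Q x = 1) :
    ∑ x, (√(P x) - √(Q x)) ^ 2 = 2 - 2 * ∑ x, √(P x * Q x) := by
  have : ∀ x, (√(P x) - √(Q x)) ^ 2 = P x + Q x - 2 * √(P x * Q x) := fun x => by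
    rw [sub_sq, Real.sq_sqrt (hP x), Real.sq_sqrt (hQ x), Real.sqrt_mul (hP x)]
    ring
  simp_rw [this]
  rw [Finset.sum_sub_distrib, Finset.sum_add_distrib, hP1, hQ1, ← Finset.mul_sum]
  norm_num

theorem hellingerDist_sq (X Y : PMF 𝒳) :
    hellingerDist X Y ^ 2 = 1 - ∑ x, √((X x).toReal * (Y x).toReal) := by
  rw [hellingerDist, Real.sq_sqrt (mul_nonneg (by norm_num)
    (Finset.sum_nonneg fun x _ => sq_nonneg _)),
    sum_sq_sqrt_sub (fun _ => ENNReal.toReal_nonneg) (fun _ => ENNReal.toReal_nonneg)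
      X.sum_toReal_eq_one Y.sum_toReal_eq_one]
  ring

theorem hellingerDist_nonneg (X Y : PMF 𝒳) : 0 ≤ hellingerDist X Y := Real.sqrt_nonneg _

/-- The total variation distance is at most `√2` times the Hellinger distance. -/
theorem sq_sum_sub_mul_le {P Q F : 𝒳 → ℝ} (hP : ∀ x, 0 ≤ P x) (hQ : ∀ x, 0 ≤ Q x)
    (hP1 : ∑ x, P x = 1) (hQ1 : ∑ x, Q x = 1) (hF0 : ∀ x, 0 ≤ F x) (hF1 : ∀ x, F x ≤ 1) :
    (∑ x, (P x - Q x) * F x) ^ 2 ≤ 2 - 2 * ∑ x, √(P x * Q x) := by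
  -- Centering `F` at `1 / 2` saves the factor `2` between total variation and `ℓ¹` distance.
  have h1 : ∑ x, (P x - Q x) * F x =
      ∑ x, (√(P x) - √(Q x)) * ((√(P x) + √(Q x)) * (F x - 1 / 2)) := by
    have h2 : ∑ x, (P x - Q x) * (1 / 2) = 0 := by
      rw [← Finset.sum_mul, Finset.sum_sub_distrib, hP1, hQ1]; ring
    rw [← sub_zero (∑ x, (P x - Q x) * F x), ← h2, ← Finset.sum_sub_distrib]
    refine Finset.sum_congr rfl fun x _ => ?_
    have e1 := Real.sq_sqrt (hP x)
    have e2 := Real.sq_sqrt (hQ x)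
    linear_combination (1 / 2 - F x) * e1 + (F x - 1 / 2) * e2
  have h3 : ∑ x, ((√(P x) + √(Q x)) * (F x - 1 / 2)) ^ 2 ≤ 1 := by
    calc _ ≤ ∑ x, (P x + Q x) * (1 / 2) := Finset.sum_le_sum fun x _ => by
          have e1 := Real.sq_sqrt (hP x)
          have e2 := Real.sq_sqrt (hQ x)
          have e3 : (F x - 1 / 2) ^ 2 ≤ 1 / 4 := by nlinarith [hF0 x, hF1 x]
          have e4 : (√(P x) + √(Q x)) ^ 2 ≤ 2 * (P x + Q x) := by
            nlinarith [sq_nonneg (√(P x) - √(Q x))]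
          rw [mul_pow]
          calc _ ≤ 2 * (P x + Q x) * (1 / 4) :=
                mul_le_mul e4 e3 (sq_nonneg _) (by linarith [hP x, hQ x])
            _ = _ := by ring
      _ = 1 := by rw [← Finset.sum_mul, Finset.sum_add_distrib, hP1, hQ1]; norm_num
  rw [h1, ← sum_sq_sqrt_sub hP hQ hP1 hQ1]
  refine (Finset.sum_mul_sq_le_sq_mul_sq _ _ _).trans ?_
  exact mul_le_of_le_one_right (Finset.sum_nonneg fun x _ => sq_nonneg _) h3

/-- The Bhattacharyya coefficient is multiplicative. -/
theorem sum_sqrt_prod_mul_prod {p q : 𝒳 → ℝ} (hp : ∀ x, 0 ≤ p x) (hq : ∀ x, 0 ≤ q x) (k : ℕ) :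
    ∑ x : Fin k → 𝒳, √((∏ i, p (x i)) * ∏ i, q (x i)) = (∑ a, √(p a * q a)) ^ k := by
  rw [← sum_prod_eq_pow]
  refine Finset.sum_congr rfl fun x _ => ?_
  rw [← Finset.prod_mul_distrib, Real.sqrt_prod _ fun i _ => mul_nonneg (hp _) (hq _)]

/-- No test on `k` independent samples has advantage more than `√(2k) d_H`. -/
theorem abs_iidExp_sub_le_sqrt (X Y : PMF 𝒳) (k : ℕ) {F : (Fin k → 𝒳) → ℝ} (hF0 : ∀ x, 0 ≤ F x)
    (hF1 : ∀ x, F x ≤ 1) :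
    |iidExp (fun x => (X x).toReal) k F - iidExp (fun x => (Y x).toReal) k F| ≤
      √(2 * k * hellingerDist X Y ^ 2) := by
  have hprod : ∀ (Z : PMF 𝒳) (x : Fin k → 𝒳), 0 ≤ ∏ i, (Z (x i)).toReal := fun Z x =>
    Finset.prod_nonneg fun i _ => ENNReal.toReal_nonneg
  have hone : ∀ Z : PMF 𝒳, ∑ x : Fin k → 𝒳, ∏ i, (Z (x i)).toReal = 1 := fun Z => by
    rw [sum_prod_eq_pow fun a => (Z a).toReal, Z.sum_toReal_eq_one, one_pow]
  refine Real.abs_le_sqrt ?_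
  have h := sq_sum_sub_mul_le (hprod X) (hprod Y) (hone X) (hone Y) hF0 hF1
  rw [sum_sqrt_prod_mul_prod (p := fun a => (X a).toReal) (q := fun a => (Y a).toReal)
    (fun _ => ENNReal.toReal_nonneg) (fun _ => ENNReal.toReal_nonneg)] at h
  unfold iidExp
  rw [← Finset.sum_sub_distrib]
  simp_rw [← sub_mul]
  refine h.trans ?_
  rw [hellingerDist_sq]
  have hbc : 0 ≤ ∑ x, √((X x).toReal * (Y x).toReal) :=
    Finset.sum_nonneg fun x _ => Real.sqrt_nonneg _
  have hb := one_add_mul_le_pow (a := ∑ x, √((X x).toReal * (Y x).toReal) - 1) (by linarith) k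
  rw [add_sub_cancel] at hb
  linarith

end Hellinger

/-! ### A calibrated partition of low complexity -/

section Calibration

variable {𝒳 : Type u} [Fintype 𝒳]

/-- The average of `g = p / w` with respect to the weights `w` over the level sets of `S`;
on a level set of weight `0` it is `0`, from the division by zero. -/
noncomputable def levelAverage {A : Type*} [DecidableEq A] (w p : 𝒳 → ℝ) (S : 𝒳 → A) (a : A) : ℝ :=
  (∑ x, if S x = a then p x else 0) / ∑ x, if S x = a then w x else 0

variable {A : Type*} [DecidableEq A] {w p : 𝒳 → ℝ} {S : 𝒳 → A}

theorem levelAverage_nonneg (hp : ∀ x, 0 ≤ p x) (hw : ∀ x, p x ≤ w x) (a : A) :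
    0 ≤ levelAverage w p S a :=
  div_nonneg (Finset.sum_nonneg fun x _ => by split_ifs <;> simp [hp x])
    (Finset.sum_nonneg fun x _ => by split_ifs <;> simp [(hp x).trans (hw x)])

theorem levelAverage_le_one (hp : ∀ x, 0 ≤ p x) (hw : ∀ x, p x ≤ w x) (a : A) :
    levelAverage w p S a ≤ 1 :=
  div_le_one_of_le₀ (Finset.sum_le_sum fun x _ => by split_ifs <;> simp [hw x])
    (Finset.sum_nonneg fun x _ => by split_ifs <;> simp [(hp x).trans (hw x)])

theorem sum_level_eq (hp : ∀ x, 0 ≤ p x) (hw : ∀ x, p x ≤ w x) (a : A) :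
    (∑ x, if S x = a then p x else 0) =
      levelAverage w p S a * ∑ x, if S x = a then w x else 0 := by
  unfold levelAverage
  rcases eq_or_ne (∑ x, if S x = a then w x else 0) 0 with h | h
  · have h1 : (∑ x, if S x = a then p x else 0) ≤ ∑ x, if S x = a then w x else 0 :=
      Finset.sum_le_sum fun x _ => by split_ifs <;> simp [hw x]
    have h2 : 0 ≤ ∑ x, if S x = a then p x else 0 :=
      Finset.sum_nonneg fun x _ => by split_ifs <;> simp [hp x]
    rw [h, mul_zero]
    linarith
  · rw [div_mul_cancel₀ _ h]

/-- On functions of `S`, the weights `p` and `w * levelAverage` have the same integral. -/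
theorem sum_sub_levelAverage_mul [Fintype A] (hp : ∀ x, 0 ≤ p x) (hw : ∀ x, p x ≤ w x)
    (φ : A → ℝ) : ∑ x, (p x - w x * levelAverage w p S (S x)) * φ (S x) = 0 := by
  have h : ∀ x, (p x - w x * levelAverage w p S (S x)) * φ (S x) =
      ∑ a, ((if S x = a then p x else 0) -
        levelAverage w p S a * (if S x = a then w x else 0)) * φ a := fun x => by
    rw [Finset.sum_eq_single (S x)]
    · rw [if_pos rfl, if_pos rfl]; ring
    · intro b _ hb; simp [hb.symm]
    · simp
  simp_rw [h]
  rw [Finset.sum_comm]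
  refine Finset.sum_eq_zero fun a _ => ?_
  rw [← Finset.sum_mul, Finset.sum_sub_distrib, ← Finset.mul_sum, ← sum_level_eq hp hw, sub_self,
    zero_mul]

/-- The squared error `∑ w (h - p / w)²` of the predictor `h`, up to a constant. -/
def squareLoss (w p h : 𝒳 → ℝ) : ℝ := ∑ x, (w x * h x ^ 2 - 2 * p x * h x)

theorem neg_sum_le_squareLoss (hp : ∀ x, 0 ≤ p x) (hw : ∀ x, p x ≤ w x) (h : 𝒳 → ℝ) :
    -∑ x, p x ≤ squareLoss w p h := by
  unfold squareLoss
  rw [← Finset.sum_neg_distrib]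
  refine Finset.sum_le_sum fun x _ => ?_
  nlinarith [mul_nonneg (hp x) (sq_nonneg (1 - h x)),
    mul_nonneg (sub_nonneg.2 (hw x)) (sq_nonneg (h x))]

/-- Among the functions of `S`, averaging over the level sets minimizes the loss. -/
theorem squareLoss_levelAverage_le [Fintype A] (hp : ∀ x, 0 ≤ p x) (hw : ∀ x, p x ≤ w x)
    (v : A → ℝ) :
    squareLoss w p (fun x => levelAverage w p S (S x)) ≤ squareLoss w p fun x => v (S x) := by
  have h := sum_sub_levelAverage_mul (S := S) hp hw (fun a => levelAverage w p S a - v a)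
  rw [← sub_nonneg]
  have h2 : squareLoss w p (fun x => v (S x)) -
      squareLoss w p (fun x => levelAverage w p S (S x)) =
      ∑ x, w x * (v (S x) - levelAverage w p S (S x)) ^ 2 +
        2 * ∑ x, (p x - w x * levelAverage w p S (S x)) * (levelAverage w p S (S x) - v (S x)) := by
    unfold squareLoss
    rw [Finset.mul_sum, ← Finset.sum_sub_distrib, ← Finset.sum_add_distrib]
    exact Finset.sum_congr rfl fun x _ => by ring
  rw [h2, h, mul_zero, add_zero]
  exact Finset.sum_nonneg fun x _ => mul_nonneg ((hp x).trans (hw x)) (sq_nonneg _)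

/-- The clipping of `t` to `[0, 1]`, rounded down to the grid `{0, 1/N, …, 1}`; the grid point
`i / N` is represented by `i`. -/
noncomputable def gridRound (N : ℕ) (t : ℝ) : Fin (N + 1) :=
  ⟨⌊max 0 (min 1 t) * N⌋₊, by
    have h : max 0 (min 1 t) * N ≤ N :=
      mul_le_of_le_one_left (Nat.cast_nonneg N) (max_le zero_le_one (min_le_left _ _))
    have := Nat.floor_le_floor h
    rw [Nat.floor_natCast] at this
    omega⟩

/-- Clipping does not increase the loss, and rounding increases it by at most `2w / N`. -/
theorem loss_gridRound_le {N : ℕ} (hN : 0 < N) {a b : ℝ} (ha : 0 ≤ a) (hab : a ≤ b) (t : ℝ) :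
    b * ((gridRound N t : ℕ) / N : ℝ) ^ 2 - 2 * a * ((gridRound N t : ℕ) / N : ℝ) ≤
      b * t ^ 2 - 2 * a * t + 2 * b / N := by
  have hN' : (0 : ℝ) < N := Nat.cast_pos.2 hN
  set c := max 0 (min 1 t) with hc
  have hc0 : 0 ≤ c := le_max_left _ _
  have hc1 : c ≤ 1 := max_le zero_le_one (min_le_left _ _)
  have h1 : b * c ^ 2 - 2 * a * c ≤ b * t ^ 2 - 2 * a * t := by
    rcases le_total t 0 with ht | ht
    · have : c = 0 := by rw [hc, min_eq_right (by linarith), max_eq_left ht]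
      rw [this]
      nlinarith [mul_nonneg (ha.trans hab) (sq_nonneg t), mul_nonneg ha (neg_nonneg.2 ht)]
    · rcases le_total t 1 with ht1 | ht1
      · have : c = t := by rw [hc, min_eq_right ht1, max_eq_right ht]
        rw [this]
      · have : c = 1 := by rw [hc, min_eq_left ht1, max_eq_right zero_le_one]
        rw [this]
        nlinarith [mul_nonneg (sub_nonneg.2 hab) (sub_nonneg.2 ht1),
          mul_nonneg (ha.trans hab) (sq_nonneg (t - 1))]
  have hg : ((gridRound N t : ℕ) : ℝ) = (⌊c * N⌋₊ : ℝ) := rfl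
  set d : ℝ := (gridRound N t : ℕ) / N with hd
  have hd0 : 0 ≤ d := by positivity
  have hdc : d ≤ c := by
    rw [hd, hg, div_le_iff₀ hN']
    exact Nat.floor_le (by positivity)
  have hcd : c - 1 / N ≤ d := by
    rw [hd, hg, le_div_iff₀ hN', sub_mul, div_mul_cancel₀ _ hN'.ne']
    linarith [Nat.lt_floor_add_one (c * (N : ℝ))]
  have h2 : b * d ^ 2 - 2 * a * d ≤ b * c ^ 2 - 2 * a * c + 2 * b * (c - d) := by
    nlinarith [mul_nonneg (ha.trans hab) (mul_nonneg (sub_nonneg.2 hdc) (add_nonneg hc0 hd0)),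
      mul_nonneg (sub_nonneg.2 hab) (sub_nonneg.2 hdc)]
  have h3 : 2 * b * (c - d) ≤ 2 * b / N := by
    rw [show 2 * b / (N : ℝ) = 2 * b * (1 / N) by ring]
    exact mul_le_mul_of_nonneg_left (by linarith) (by linarith)
  linarith

/-- Boosting step: a test `f` that the current predictor fails gives a finite-state update that
decreases the loss by `ε² / 4`. -/
theorem exists_update_of_lt (hp : ∀ x, 0 ≤ p x) (hw : ∀ x, p x ≤ w x) (hw2 : ∑ x, w x = 2)
    {A : Type*} {S : 𝒳 → A} {h : 𝒳 → ℝ} {v : A → ℝ} (hv : ∀ x, h x = v (S x))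
    (f : 𝒳 → Bool) {ε : ℝ} (hε : 0 < ε) {N : ℕ}
    (hN : 16 ≤ N * ε ^ 2)
    (hf : ε < |∑ x, (p x - w x * h x) * if f x then 1 else 0|) :
    ∃ τ : A → Bool → Fin (N + 1),
      squareLoss w p (fun x => ((τ (S x) (f x) : ℕ) : ℝ) / N) ≤ squareLoss w p h - ε ^ 2 / 4 := by
  have hN0 : 0 < N := by
    rcases Nat.eq_zero_or_pos N with rfl | h0
    · norm_num at hN
    · exact h0
  have hN' : (0 : ℝ) < N := Nat.cast_pos.2 hN0
  set B := ∑ x, (p x - w x * h x) * (if f x then (1 : ℝ) else 0) with hB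
  obtain ⟨η, hη, hηB⟩ : ∃ η : ℝ, η ^ 2 = (ε / 2) ^ 2 ∧ ε ^ 2 / 2 ≤ η * B := by
    rcases lt_abs.1 hf with h1 | h1
    · exact ⟨ε / 2, rfl, by nlinarith⟩
    · exact ⟨-(ε / 2), by ring, by nlinarith⟩
  refine ⟨fun a b => gridRound N (v a + η * if b then 1 else 0), ?_⟩
  have h1 : squareLoss w p
        (fun x => ((gridRound N (v (S x) + η * if f x then 1 else 0) : ℕ) : ℝ) / N) ≤
      ∑ x, ((w x * (h x + η * if f x then 1 else 0) ^ 2 -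
          2 * p x * (h x + η * if f x then 1 else 0)) + w x * (2 / N)) := by
    refine Finset.sum_le_sum fun x _ => ?_
    rw [hv x]
    refine (loss_gridRound_le hN0 (hp x) (hw x) _).trans (le_of_eq ?_)
    ring
  have h2 : ∑ x, ((w x * (h x + η * if f x then 1 else 0) ^ 2 -
          2 * p x * (h x + η * if f x then 1 else 0)) + w x * (2 / N)) ≤
      ∑ x, ((w x * h x ^ 2 - 2 * p x * h x) -
        2 * η * ((p x - w x * h x) * (if f x then (1 : ℝ) else 0)) + w x * (η ^ 2 + 2 / N)) := by
    refine Finset.sum_le_sum fun x _ => ?_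
    have hwx := mul_nonneg ((hp x).trans (hw x)) (sq_nonneg η)
    split_ifs <;> nlinarith
  refine h1.trans (h2.trans ?_)
  rw [Finset.sum_add_distrib, Finset.sum_sub_distrib, ← Finset.mul_sum, ← Finset.sum_mul, ← hB,
    hw2, hη]
  have h3 : (2 : ℝ) / N ≤ ε ^ 2 / 8 := by
    rw [div_le_iff₀ hN']
    nlinarith
  unfold squareLoss
  nlinarith

/-- There is a finite-valued function `S`, computed from `O(1 / ε²)` circuits of size `s`, such that
no circuit of size `s` distinguishes `p` from `w * levelAverage w p S` with advantage more than
`ε`. -/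
theorem exists_calibrated {ι : Type} (e : 𝒳 → ι → Bool) (s : ℕ) (hp : ∀ x, 0 ≤ p x)
    (hw : ∀ x, p x ≤ w x) (hp1 : ∑ x, p x = 1) (hw2 : ∑ x, w x = 2) {ε : ℝ} (hε : 0 < ε)
    {N T : ℕ} (hN : 16 ≤ N * ε ^ 2) (hT : 4 < T * ε ^ 2) :
    ∃ S : (ι → Bool) → Fin (N + 1), OneHotComputed (T * (s + 1 + 4 * (N + 1) ^ 2)) S ∧
      ∀ c : Circuit ι, c.size ≤ s →
        |∑ x, (p x - w x * levelAverage w p (fun x => S (e x)) (S (e x))) *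
          if c.eval (e x) then 1 else 0| ≤ ε := by
  by_contra! hcon
  have key : ∀ t ≤ T, ∃ S : (ι → Bool) → Fin (N + 1),
      OneHotComputed (t * (s + 1 + 4 * (N + 1) ^ 2)) S ∧
        squareLoss w p (fun x => ((S (e x) : ℕ) : ℝ) / N) ≤ -(t * (ε ^ 2 / 4)) := by
    intro t
    induction t with
    | zero =>
      intro _
      refine ⟨fun _ => 0, by simpa using OneHotComputed.const (ι := ι) (0 : Fin (N + 1)), ?_⟩
      simp [squareLoss]
    | succ t ih =>
      intro ht
      obtain ⟨S, hS, hloss⟩ := ih (by omega)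
      obtain ⟨c, hc, hbad⟩ := hcon S (hS.mono (Nat.mul_le_mul_right _ (by omega)))
      obtain ⟨τ, hτ⟩ := exists_update_of_lt (S := fun x => S (e x)) hp hw hw2
        (v := levelAverage w p fun x => S (e x)) (fun x => rfl) (fun x => c.eval (e x)) hε hN hbad
      refine ⟨fun x => τ (S x) (c.eval x), ?_, ?_⟩
      · refine (hS.combine (OneHotComputed.of_circuit c) τ).mono ?_
        simp only [Fintype.card_fin, Fintype.card_bool]
        nlinarith
      · refine hτ.trans ?_
        have := squareLoss_levelAverage_le (S := fun x => S (e x)) hp hw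
          fun a => ((a : ℕ) : ℝ) / N
        push_cast
        linarith
  obtain ⟨S, -, hS⟩ := key T le_rfl
  have := neg_sum_le_squareLoss hp hw fun x => ((S (e x) : ℕ) : ℝ) / N
  rw [hp1] at this
  linarith

end Calibration

/-! ### The rounded likelihood-ratio test -/

/-- The log-likelihood ratio `log (t / (1 - t))`, smoothed by `ε / 16` and rounded down to a
multiple of `ε / 2`; the multiple `i * (ε / 2)` is represented by `i`. -/
noncomputable def ratioScore (ε t : ℝ) : ℤ :=
  ⌊Real.log ((t + ε / 16) / (1 - t + ε / 16)) / (ε / 2)⌋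

theorem log_smoothed_ratio_le {ε t : ℝ} (hε : 0 < ε) (ht0 : 0 ≤ t) (ht1 : t ≤ 1) :
    Real.log ((t + ε / 16) / (1 - t + ε / 16)) ≤ 16 / ε := by
  have h1 : 0 < 1 - t + ε / 16 := by linarith
  have h2 : 0 < (t + ε / 16) / (1 - t + ε / 16) := by positivity
  refine (Real.log_le_sub_one_of_pos h2).trans ?_
  rw [sub_le_iff_le_add, div_le_iff₀ h1]
  have h3 : (16 / ε + 1) * (ε / 16) = 1 + ε / 16 := by field_simp
  have h4 : 0 ≤ (16 / ε + 1) * (1 - t) := by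
    have : 0 ≤ 16 / ε := by positivity
    nlinarith
  nlinarith

theorem abs_ratioScore_le {ε t : ℝ} (hε : 0 < ε) (hε1 : ε ≤ 1) (ht0 : 0 ≤ t) (ht1 : t ≤ 1) :
    |(ratioScore ε t : ℝ)| ≤ 33 / ε ^ 2 := by
  have h1 := log_smoothed_ratio_le hε ht0 ht1
  have h2 : -(16 / ε) ≤ Real.log ((t + ε / 16) / (1 - t + ε / 16)) := by
    have h := log_smoothed_ratio_le hε (sub_nonneg.2 ht1) (by linarith : 1 - t ≤ 1)
    rw [sub_sub_cancel, ← inv_div, Real.log_inv] at h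
    linarith
  have hd : 16 / ε / (ε / 2) = 32 / ε ^ 2 := by field_simp; norm_num
  have h3 : Real.log ((t + ε / 16) / (1 - t + ε / 16)) / (ε / 2) ≤ 32 / ε ^ 2 := by
    rw [← hd]; gcongr
  have h4 : -(32 / ε ^ 2) ≤ Real.log ((t + ε / 16) / (1 - t + ε / 16)) / (ε / 2) := by
    rw [← hd, ← neg_div]; gcongr
  have h5 : 1 ≤ 1 / ε ^ 2 := by
    rw [le_div_iff₀ (by positivity)]; nlinarith
  have h6 : 33 / ε ^ 2 = 32 / ε ^ 2 + 1 / ε ^ 2 := by ring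
  have h7 := Int.floor_le (Real.log ((t + ε / 16) / (1 - t + ε / 16)) / (ε / 2))
  have h8 := Int.lt_floor_add_one (Real.log ((t + ε / 16) / (1 - t + ε / 16)) / (ε / 2))
  rw [abs_le, ratioScore]
  constructor <;> linarith

section Test

variable {𝒳 : Type u} [Fintype 𝒳]

/-- The likelihood-ratio test shows that total variation is at least the squared Hellinger
distance; the latter is tensorized through the Bhattacharyya coefficient. -/
theorem exists_test_iidExp {p q : 𝒳 → ℝ} (hp : ∀ x, 0 ≤ p x) (hq : ∀ x, 0 ≤ q x)
    (hp1 : ∑ x, p x = 1) (k : ℕ) :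
    ∃ F : (Fin k → 𝒳) → ℝ, (∀ x, 0 ≤ F x) ∧ (∀ x, F x ≤ 1) ∧
      1 - (∑ x, √(p x * q x)) ^ k ≤ iidExp p k F - iidExp q k F := by
  classical
  refine ⟨fun x => if ∏ i, q (x i) ≤ ∏ i, p (x i) then 1 else 0,
    fun x => by dsimp only; split_ifs <;> norm_num,
    fun x => by dsimp only; split_ifs <;> norm_num, ?_⟩
  have hone : ∑ x : Fin k → 𝒳, ∏ i, p (x i) = 1 := by rw [sum_prod_eq_pow, hp1, one_pow]
  rw [← sum_sqrt_prod_mul_prod hp hq]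
  unfold iidExp
  rw [← Finset.sum_sub_distrib]
  refine (sub_le_sub_right hone.ge _).trans ?_
  rw [← Finset.sum_sub_distrib]
  refine Finset.sum_le_sum fun x _ => ?_
  have hP := Finset.prod_nonneg fun i (_ : i ∈ Finset.univ) => hp (x i)
  have hQ := Finset.prod_nonneg fun i (_ : i ∈ Finset.univ) => hq (x i)
  dsimp only
  split_ifs with h
  · have : ∏ i, q (x i) ≤ √((∏ i, p (x i)) * ∏ i, q (x i)) := Real.le_sqrt_of_sq_le (by nlinarith)
    linarith
  · have : ∏ i, p (x i) ≤ √((∏ i, p (x i)) * ∏ i, q (x i)) :=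
      Real.le_sqrt_of_sq_le (by nlinarith [not_le.1 h])
    linarith

/-- Let `w * u` and `w * (1 - u)` be probability weights. The test that adds up the rounded scores
of `u` loses at most `2kε` compared with the likelihood-ratio test. -/
theorem le_iidExp_ratioScore_test {w u : 𝒳 → ℝ} (hw : ∀ x, 0 ≤ w x) (hu0 : ∀ x, 0 ≤ u x)
    (hu1 : ∀ x, u x ≤ 1) (h1 : ∑ x, w x * u x = 1) (h0 : ∑ x, w x * (1 - u x) = 1) {ε : ℝ}
    (hε : 0 < ε) {k : ℕ} (hk : k * ε ≤ 1) :
    1 - (∑ x, √(w x * u x * (w x * (1 - u x)))) ^ k - 2 * k * ε ≤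
      iidExp (fun x => w x * u x) k
          (fun x => if 0 ≤ ∑ i, ratioScore ε (u (x i)) then 1 else 0) -
        iidExp (fun x => w x * (1 - u x)) k
          (fun x => if 0 ≤ ∑ i, ratioScore ε (u (x i)) then 1 else 0) := by
  have hp : ∀ x, 0 ≤ w x * u x := fun x => mul_nonneg (hw x) (hu0 x)
  have hq : ∀ x, 0 ≤ w x * (1 - u x) := fun x => mul_nonneg (hw x) (sub_nonneg.2 (hu1 x))
  have hw2 : ∑ x, w x = 2 := by
    have : ∑ x, w x = ∑ x, w x * u x + ∑ x, w x * (1 - u x) := by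
      rw [← Finset.sum_add_distrib]; exact Finset.sum_congr rfl fun x _ => by ring
    rw [this, h1, h0]; norm_num
  -- Mixing with weight `ε / 8` of `w / 2` bounds the log-likelihood ratio.
  let m : (𝒳 → ℝ) → 𝒳 → ℝ := fun t x => w x * (t x + ε / 16) / (1 + ε / 8)
  have hε8 : 0 < 1 + ε / 8 := by linarith
  have hm0 : ∀ t : 𝒳 → ℝ, (∀ x, 0 ≤ t x) → ∀ x, 0 ≤ m t x := fun t ht x => by
    have := ht x
    have := hw x
    simp only [m]; positivity
  have hm1 : ∀ t : 𝒳 → ℝ, ∑ x, w x * t x = 1 → ∑ x, m t x = 1 := fun t ht => by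
    simp only [m, mul_add]
    rw [← Finset.sum_div, Finset.sum_add_distrib, ht, ← Finset.sum_mul, hw2,
      div_eq_one_iff_eq hε8.ne']
    ring
  have hmix : ∀ t : 𝒳 → ℝ, (∀ x, 0 ≤ t x) → (∀ x, t x ≤ 1) → ∑ x, w x * t x = 1 →
      ∀ F : (Fin k → 𝒳) → ℝ, (∀ x, 0 ≤ F x) → (∀ x, F x ≤ 1) →
        |iidExp (fun x => w x * t x) k F - iidExp (m t) k F| ≤ k * (ε / 8) := by
    intro t ht0 ht1 ht F hF0 hF1
    refine abs_iidExp_sub_le (fun x => mul_nonneg (hw x) (ht0 x)) ht (hm0 t ht0) (hm1 t ht) F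
      fun i x => ?_
    refine (Finset.abs_sum_le_sum_abs _ _).trans ?_
    calc _ ≤ ∑ a, w a * (ε / 16) := Finset.sum_le_sum fun a _ => by
          have e : w a * t a - m t a = w a * (ε / 16) * ((2 * t a - 1) / (1 + ε / 8)) := by
            simp only [m]; field_simp; ring
          have e1 : |(2 * t a - 1) / (1 + ε / 8)| ≤ 1 := by
            rw [abs_div, abs_of_pos hε8, div_le_one hε8, abs_le]
            constructor <;> linarith [ht0 a, ht1 a]
          have e2 : 0 ≤ w a * (ε / 16) := mul_nonneg (hw a) (by positivity)
          rw [e, abs_mul, abs_mul, abs_of_nonneg e2, abs_of_nonneg (hF0 _), mul_assoc]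
          exact mul_le_of_le_one_right e2 (mul_le_one₀ e1 (hF0 _) (hF1 _))
      _ = ε / 8 := by rw [← Finset.sum_mul, hw2]; ring
  obtain ⟨F, hF0, hF1, hF⟩ := exists_test_iidExp hp hq h1 k
  set G : (Fin k → 𝒳) → ℝ := fun x => if 0 ≤ ∑ i, ratioScore ε (u (x i)) then 1 else 0 with hG
  have hG0 : ∀ x, 0 ≤ G x := fun x => by simp only [hG]; split_ifs <;> norm_num
  have hG1 : ∀ x, G x ≤ 1 := fun x => by simp only [hG]; split_ifs <;> norm_num
  have hu0' : ∀ x, 0 ≤ 1 - u x := fun x => sub_nonneg.2 (hu1 x)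
  have hu1' : ∀ x, 1 - u x ≤ 1 := fun x => by linarith [hu0 x]
  -- The rounding error of the scores costs a factor `exp (kε / 2)` in the likelihood ratio.
  have hround : iidExp (m u) k F - iidExp (m fun x => 1 - u x) k F - k * ε ≤
      iidExp (m u) k G - iidExp (m fun x => 1 - u x) k G := by
    have hke : Real.exp (k * ε / 2) - 1 ≤ k * ε := by
      have hk0 : 0 ≤ k * ε := by positivity
      have := Real.abs_exp_sub_one_le (x := k * ε / 2) (by rw [abs_of_nonneg] <;> linarith)
      rw [abs_of_nonneg (by linarith : 0 ≤ k * ε / 2)] at this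
      linarith [le_abs_self (Real.exp (k * ε / 2) - 1)]
    have hone := iidExp_const (hm1 _ h0) k (Real.exp (k * ε / 2) - 1)
    suffices h : iidExp (m u) k F - iidExp (m fun x => 1 - u x) k F -
        iidExp (m fun x => 1 - u x) k (fun _ => Real.exp (k * ε / 2) - 1) ≤
        iidExp (m u) k G - iidExp (m fun x => 1 - u x) k G by linarith
    unfold iidExp
    rw [← Finset.sum_sub_distrib, ← Finset.sum_sub_distrib, ← Finset.sum_sub_distrib]
    refine Finset.sum_le_sum fun x _ => ?_
    let l : 𝒳 → ℝ := fun a => Real.log ((u a + ε / 16) / (1 - u a + ε / 16))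
    have hl : ∀ a, m u a = Real.exp (l a) * m (fun x => 1 - u x) a := fun a => by
      have e1 : 0 < u a + ε / 16 := by linarith [hu0 a]
      have e2 : 0 < 1 - u a + ε / 16 := by linarith [hu0' a]
      simp only [l, m]
      rw [Real.exp_log (by positivity)]
      linear_combination
        -(w a / (1 + ε / 8)) * div_mul_cancel₀ (u a + ε / 16) e2.ne'
    have hR : ∏ i, m u (x i) = Real.exp (∑ i, l (x i)) * ∏ i, m (fun x => 1 - u x) (x i) := by
      rw [Real.exp_sum, ← Finset.prod_mul_distrib]
      exact Finset.prod_congr rfl fun i _ => hl _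
    have hR0 : 0 ≤ ∏ i, m (fun x => 1 - u x) (x i) :=
      Finset.prod_nonneg fun i _ => hm0 _ hu0' _
    have hlow : ((∑ i, ratioScore ε (u (x i)) : ℤ) : ℝ) * (ε / 2) ≤ ∑ i, l (x i) := by
      push_cast
      rw [Finset.sum_mul]
      refine Finset.sum_le_sum fun i _ => ?_
      rw [← le_div_iff₀ (by positivity)]
      exact Int.floor_le _
    have hupp : ∑ i, l (x i) ≤ ((∑ i, ratioScore ε (u (x i)) : ℤ) : ℝ) * (ε / 2) + k * ε / 2 := by
      have : ∑ i, l (x i) ≤ ∑ i, ((ratioScore ε (u (x i)) : ℝ) + 1) * (ε / 2) := by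
        refine Finset.sum_le_sum fun i _ => ?_
        rw [← div_le_iff₀ (by positivity)]
        exact (Int.lt_floor_add_one _).le
      refine this.trans (le_of_eq ?_)
      rw [← Finset.sum_mul, Finset.sum_add_distrib]
      push_cast
      simp
      ring
    rw [hR]
    set R := ∏ i, m (fun x => 1 - u x) (x i)
    have hexp1 : 1 ≤ Real.exp (k * ε / 2) := Real.one_le_exp (by positivity)
    have hc : 0 ≤ R * (Real.exp (k * ε / 2) - 1) := mul_nonneg hR0 (by linarith)
    by_cases hz : 0 ≤ ∑ i, ratioScore ε (u (x i))
    · have hGx : G x = 1 := if_pos hz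
      have : 1 ≤ Real.exp (∑ i, l (x i)) := Real.one_le_exp (le_trans (by positivity) hlow)
      rw [hGx]
      nlinarith [mul_nonneg (mul_nonneg hR0 (sub_nonneg.2 this)) (sub_nonneg.2 (hF1 x))]
    · have hGx : G x = 0 := if_neg hz
      have hz' : ((∑ i, ratioScore ε (u (x i)) : ℤ) : ℝ) ≤ 0 := by exact_mod_cast (not_le.1 hz).le
      have : Real.exp (∑ i, l (x i)) ≤ Real.exp (k * ε / 2) := Real.exp_le_exp.2 (by nlinarith)
      rw [hGx]
      nlinarith [mul_nonneg (mul_nonneg hR0 (sub_nonneg.2 this)) (hF0 x),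
        mul_nonneg hc (sub_nonneg.2 (hF1 x))]
  have a1 := abs_le.1 (hmix u hu0 hu1 h1 F hF0 hF1)
  have a2 := abs_le.1 (hmix u hu0 hu1 h1 G hG0 hG1)
  have a3 := abs_le.1 (hmix _ hu0' hu1' h0 F hF0 hF1)
  have a4 := abs_le.1 (hmix _ hu0' hu1' h0 G hG0 hG1)
  have hk0 : 0 ≤ k * ε := by positivity
  linarith [a1.1, a1.2, a2.1, a2.2, a3.1, a3.2, a4.1, a4.2]

end Test

/-- A circuit for the sign of a sum of bounded integers read off from `k` blocks of input bits. -/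
theorem exists_circuit_sum_nonneg {n m k N L : ℕ} {S : (Fin n → Bool) → Fin m}
    (hS : OneHotComputed N S) (z : Fin m → ℤ) (hz : ∀ a, |z a| ≤ L) :
    ∃ c : Circuit (Fin k × Fin n),
      c.size ≤ k * (N + 2 * m * (2 * k * L + 1) ^ 2) + 4 * (2 * k * L + 1) ∧
        ∀ x, c.eval x = decide (0 ≤ ∑ i, z (S fun j => x (i, j))) := by
  -- The partial sums lie in `[-kL, kL]`, so that they are determined by their residues.
  set M := 2 * k * L + 1 with hM
  have hM0 : NeZero M := ⟨by omega⟩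
  have hsum : ∀ t : Finset (Fin k), OneHotComputed (t.card * (N + 2 * m * M ^ 2))
      fun x : Fin k × Fin n → Bool => ∑ i ∈ t, (z (S fun j => x (i, j)) : ZMod M) := by
    intro t
    induction t using Finset.induction_on with
    | empty => simpa using OneHotComputed.const (ι := Fin k × Fin n) (0 : ZMod M)
    | insert i t hi ih =>
      simp_rw [Finset.sum_insert hi]
      refine ((OneHotComputed.comp_input (fun j => (i, j)) hS).combine ih
        fun a b => (z a : ZMod M) + b).mono (le_of_eq ?_)
      rw [Finset.card_insert_of_notMem hi, ZMod.card, Fintype.card_fin]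
      ring
  have hbool := (hsum Finset.univ).combine (OneHotComputed.const ())
    fun a _ => decide (0 ≤ a.valMinAbs)
  obtain ⟨c, hc, hceval⟩ := JointlyComputed.exists_circuit
    (f := fun x : Fin k × Fin n → Bool =>
      decide (0 ≤ (∑ i, (z (S fun j => x (i, j)) : ZMod M)).valMinAbs))
    (JointlyComputed.mono hbool le_rfl (by
      rintro _ rfl
      exact ⟨true, by simp⟩))
  refine ⟨c, hc.trans (le_of_eq ?_), fun x => ?_⟩
  · rw [Finset.card_univ, Fintype.card_fin, ZMod.card, Fintype.card_unit, Fintype.card_bool]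
    ring
  · rw [hceval]
    have hb : |∑ i, z (S fun j => x (i, j))| ≤ k * L := by
      refine (Finset.abs_sum_le_sum_abs _ _).trans ?_
      refine (Finset.sum_le_sum fun i _ => hz _).trans ?_
      simp
    have : (∑ i, (z (S fun j => x (i, j)) : ZMod M)).valMinAbs =
        ∑ i, z (S fun j => x (i, j)) := by
      rw [ZMod.valMinAbs_spec]
      refine ⟨by push_cast; rfl, ?_⟩
      rw [abs_le] at hb
      constructor <;> push_cast [hM] <;> linarith [hb.1, hb.2]
    simp only [this]

/-! ### Samples and the pseudo-Hellinger distance -/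

section Main

variable {𝒳 : Type u} [Fintype 𝒳] {n : ℕ}

/-- Indistinguishability passes to `k` samples: hard-wiring all samples but one costs no gates. -/
theorem Indistinguishable.abs_iidExp_sub_le {e : 𝒳 → Fin n → Bool} {s : ℕ} {ε : ℝ} {X Y : PMF 𝒳}
    (h : Indistinguishable e s ε X Y) (k : ℕ) (c : Circuit (Fin k × Fin n)) (hc : c.size ≤ s) :
    |iidExp (fun x => (X x).toReal) k (fun x => if c.eval (encTuple e k x) then 1 else 0) -
      iidExp (fun x => (Y x).toReal) k (fun x => if c.eval (encTuple e k x) then 1 else 0)| ≤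
        k * ε := by
  refine _root_.abs_iidExp_sub_le (fun _ => ENNReal.toReal_nonneg) X.sum_toReal_eq_one
    (fun _ => ENNReal.toReal_nonneg) Y.sum_toReal_eq_one _ fun i x => ?_
  obtain ⟨c', hc', hc'e⟩ := c.exists_subst (κ := Fin n)
    fun p => if p.1 = i then .input p.2 else .const (e (x p.1) p.2)
  have h' := h c' (hc'.le.trans hc)
  unfold advantage at h'
  refine le_trans (le_of_eq ?_) h'
  congr 1
  refine Finset.sum_congr rfl fun a _ => ?_
  have : c'.eval (e a) = c.eval (encTuple e k (Function.update x i a)) := by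
    rw [hc'e]
    congr 1
    funext p
    by_cases hp : p.1 = i
    · rw [if_pos hp, encTuple, hp, Function.update_self]; rfl
    · rw [if_neg hp, encTuple, Function.update_of_ne hp]; rfl
  simp only [this, mul_comm]

theorem IsPseudoHellingerDist.nonneg {e : 𝒳 → Fin n → Bool} {s : ℕ} {ε δ : ℝ} {X₀ X₁ : PMF 𝒳}
    (h : IsPseudoHellingerDist e s ε X₀ X₁ δ) : 0 ≤ δ := by
  obtain ⟨⟨Y₀, Y₁, -, -, h⟩, -⟩ := h
  exact (hellingerDist_nonneg Y₀ Y₁).trans h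

theorem hellingerDist_sq_le_one (X Y : PMF 𝒳) : hellingerDist X Y ^ 2 ≤ 1 := by
  rw [hellingerDist_sq, sub_le_self_iff]
  exact Finset.sum_nonneg fun x _ => Real.sqrt_nonneg _

theorem IsPseudoHellingerDist.sq_le_one {e : 𝒳 → Fin n → Bool} {s : ℕ} {ε δ : ℝ}
    {X₀ X₁ : PMF 𝒳} (hε : 0 < ε) (h : IsPseudoHellingerDist e s ε X₀ X₁ δ) : δ ^ 2 ≤ 1 := by
  have hself : ∀ X : PMF 𝒳, Indistinguishable e s ε X X := fun X c _ => by
    simpa [advantage] using hε.le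
  have := h.2 ⟨X₀, X₁, hself X₀, hself X₁, le_rfl⟩
  exact (pow_le_pow_left₀ h.nonneg this 2).trans (hellingerDist_sq_le_one X₀ X₁)

/-- The pseudo-Hellinger distance bounds the advantage from above. -/
theorem IsPseudoHellingerDist.indistinguishable {e : 𝒳 → Fin n → Bool} {s : ℕ} {ε δ : ℝ}
    {X₀ X₁ : PMF 𝒳} (h : IsPseudoHellingerDist e s ε X₀ X₁ δ) (k : ℕ) :
    Indistinguishable (encTuple e k) s (√(2 * k * δ ^ 2) + 2 * k * ε)
      (iidPMF X₀ k) (iidPMF X₁ k) := by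
  intro c hc
  obtain ⟨⟨Y₀, Y₁, h₀, h₁, hd⟩, -⟩ := h
  rw [advantage_iidPMF]
  have a0 := h₀.abs_iidExp_sub_le k c hc
  have a1 := h₁.abs_iidExp_sub_le k c hc
  have a2 := abs_iidExp_sub_le_sqrt Y₀ Y₁ k
    (F := fun x => if c.eval (encTuple e k x) then 1 else 0)
    (fun x => by split_ifs <;> norm_num) (fun x => by split_ifs <;> norm_num)
  have a3 : √(2 * k * hellingerDist Y₀ Y₁ ^ 2) ≤ √(2 * k * δ ^ 2) :=
    Real.sqrt_le_sqrt (mul_le_mul_of_nonneg_left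
      (pow_le_pow_left₀ (hellingerDist_nonneg _ _) hd 2) (by positivity))
  rw [abs_le] at a0 a1 a2 ⊢
  constructor <;> linarith [a0.1, a0.2, a1.1, a1.2, a2.1, a2.2]

/-- The size of the test in terms of `K ≈ 1 / ε`. -/
theorem distinguisher_size_le {k s K : ℕ} {ε : ℝ} (hε : 0 < ε) (hε1 : ε ≤ 1) (hk : 1 ≤ k)
    (hK1 : 1 ≤ K) (hK : K ≤ 2 / ε) {N : ℕ}
    (hN : N ≤ k * (5 * K ^ 2 * (s + 1 + 4 * (16 * K ^ 2 + 1) ^ 2) +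
      2 * (16 * K ^ 2 + 1) * (2 * k * (33 * K ^ 2) + 1) ^ 2) + 4 * (2 * k * (33 * K ^ 2) + 1)) :
    (N : ℝ) ≤ 20 * (s * k / ε ^ 6) + 10155456 * (k / ε) ^ 9 := by
  have h1 : N ≤ 5 * K ^ 2 * s * k + 158679 * (k ^ 3 * K ^ 6) := by
    refine hN.trans ?_
    have hK2 : 1 ≤ K ^ 2 := Nat.one_le_pow _ _ hK1
    have m1 : 16 * K ^ 2 + 1 ≤ 17 * K ^ 2 := by omega
    have m2 : 2 * k * (33 * K ^ 2) + 1 ≤ 67 * (k * K ^ 2) := by nlinarith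
    have m3 : 1 ≤ K ^ 4 := Nat.one_le_pow _ _ hK1
    have m4 : k ≤ k ^ 3 := Nat.le_self_pow (by norm_num) k
    have m5 : K ^ 2 ≤ K ^ 6 := Nat.pow_le_pow_right hK1 (by norm_num)
    calc _ ≤ k * (5 * K ^ 2 * (s + K ^ 4 + 4 * (17 * K ^ 2) ^ 2) +
            2 * (17 * K ^ 2) * (67 * (k * K ^ 2)) ^ 2) + 4 * (67 * (k * K ^ 2)) := by gcongr
      _ = 5 * K ^ 2 * s * k + (5785 * (k * K ^ 6) + 152626 * (k ^ 3 * K ^ 6) +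
            268 * (k * K ^ 2)) := by ring
      _ ≤ 5 * K ^ 2 * s * k + (5785 * (k ^ 3 * K ^ 6) + 152626 * (k ^ 3 * K ^ 6) +
            268 * (k ^ 3 * K ^ 6)) := by gcongr
      _ = _ := by ring
  have h2 : (N : ℝ) ≤ 5 * (K : ℝ) ^ 2 * s * k + 158679 * ((k : ℝ) ^ 3 * (K : ℝ) ^ 6) := by
    exact_mod_cast h1
  have hk' : (1 : ℝ) ≤ k := by exact_mod_cast hk
  refine h2.trans (add_le_add ?_ ?_)
  · calc 5 * (K : ℝ) ^ 2 * s * k ≤ 5 * (2 / ε) ^ 2 * s * k := by gcongr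
      _ = 20 * (s * k / ε ^ 2) := by ring
      _ ≤ _ := by
        gcongr 20 * (s * k / ?_)
        exact pow_le_pow_of_le_one hε.le hε1 (by norm_num)
  · have hky : (k : ℝ) ≤ k / ε := by
      rw [le_div_iff₀ hε]; nlinarith
    have hKy : (K : ℝ) ≤ 2 * (k / ε) := by
      refine hK.trans ?_
      rw [← mul_div_assoc]
      gcongr
      linarith
    calc 158679 * ((k : ℝ) ^ 3 * (K : ℝ) ^ 6) ≤
          158679 * ((k / ε) ^ 3 * (2 * (k / ε)) ^ 6) := by gcongr
      _ = _ := by ring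

/-- The pseudo-Hellinger distance bounds the advantage from below. -/
theorem IsPseudoHellingerDist.distinguishable {e : 𝒳 → Fin n → Bool} {s : ℕ} {ε δ : ℝ}
    {X₀ X₁ : PMF 𝒳} (hε : 0 < ε) (h : IsPseudoHellingerDist e s ε X₀ X₁ δ) (k : ℕ) :
    ∃ s' : ℕ, (s' : ℝ) ≤ 20 * (s * k / ε ^ 6) + 10155456 * (k / ε) ^ 9 ∧
      Distinguishable (encTuple e k) s' (1 - Real.exp (-(k * δ ^ 2)) - 2 * k * ε)
        (iidPMF X₀ k) (iidPMF X₁ k) := by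
  by_cases htriv : 1 - Real.exp (-(k * δ ^ 2)) - 2 * k * ε ≤ 0
  · refine ⟨0, by push_cast; positivity, ⟨0, .nil, .const true⟩, le_rfl, htriv.trans ?_⟩
    exact abs_nonneg _
  have hk : 1 ≤ k := by
    rcases Nat.eq_zero_or_pos k with rfl | hk
    · simp at htriv
    · exact hk
  have hk' : (1 : ℝ) ≤ k := by exact_mod_cast hk
  have hkε : 2 * k * ε < 1 := by
    have := Real.exp_pos (-(k * δ ^ 2))
    linarith
  have hε1 : ε ≤ 1 := by nlinarith
  set K := ⌈1 / ε⌉₊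
  have hKε : 1 ≤ K * ε := by
    rw [← div_le_iff₀ hε]; exact Nat.le_ceil _
  have hK2 : (K : ℝ) ≤ 2 / ε := by
    have h1 := Nat.ceil_lt_add_one (a := 1 / ε) (by positivity)
    have h2 : 1 ≤ 1 / ε := by rw [le_div_iff₀ hε]; linarith
    have h3 : 2 / ε = 1 / ε + 1 / ε := by ring
    linarith
  have hK1 : 1 ≤ K := Nat.one_le_iff_ne_zero.2 fun h0 => by
    rw [h0] at hKε; norm_num at hKε
  have hKε2 : 1 ≤ (K : ℝ) ^ 2 * ε ^ 2 := by rw [← mul_pow]; exact one_le_pow₀ hKε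
  let p₀ : 𝒳 → ℝ := fun x => (X₀ x).toReal
  let p₁ : 𝒳 → ℝ := fun x => (X₁ x).toReal
  let w : 𝒳 → ℝ := fun x => p₀ x + p₁ x
  have hp₀ : ∀ x, 0 ≤ p₀ x := fun x => ENNReal.toReal_nonneg
  have hp₁ : ∀ x, 0 ≤ p₁ x := fun x => ENNReal.toReal_nonneg
  have hw : ∀ x, p₁ x ≤ w x := fun x => le_add_of_nonneg_left (hp₀ x)
  have hw0 : ∀ x, 0 ≤ w x := fun x => (hp₁ x).trans (hw x)
  have hs₀ : ∑ x, p₀ x = 1 := X₀.sum_toReal_eq_one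
  have hs₁ : ∑ x, p₁ x = 1 := X₁.sum_toReal_eq_one
  have hw2 : ∑ x, w x = 2 := by
    simp only [w]; rw [Finset.sum_add_distrib, hs₀, hs₁]; norm_num
  obtain ⟨S, hS, hcal⟩ := exists_calibrated e s hp₁ hw hs₁ hw2 hε (N := 16 * K ^ 2)
    (T := 5 * K ^ 2) (by push_cast; nlinarith) (by push_cast; nlinarith)
  set v := levelAverage w p₁ fun x => S (e x)
  let u : 𝒳 → ℝ := fun x => v (S (e x))
  have hv0 : ∀ a, 0 ≤ v a := levelAverage_nonneg hp₁ hw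
  have hv1 : ∀ a, v a ≤ 1 := levelAverage_le_one hp₁ hw
  have hfun : ∀ φ : Fin (16 * K ^ 2 + 1) → ℝ, ∑ x, (p₁ x - w x * u x) * φ (S (e x)) = 0 :=
    fun φ => sum_sub_levelAverage_mul (S := fun x => S (e x)) hp₁ hw φ
  have hu1 : ∑ x, w x * u x = 1 := by
    have := hfun fun _ => 1
    simp only [mul_one, Finset.sum_sub_distrib] at this
    linarith
  have hu0 : ∑ x, w x * (1 - u x) = 1 := by
    simp only [mul_sub, mul_one, Finset.sum_sub_distrib]
    linarith
  have hneg : ∀ x, p₀ x - w x * (1 - u x) = -(p₁ x - w x * u x) := fun x => by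
    simp only [w]; ring
  have hwu1 : ∀ x, 0 ≤ w x * u x := fun x => mul_nonneg (hw0 x) (hv0 _)
  have hwu0 : ∀ x, 0 ≤ w x * (1 - u x) := fun x =>
    mul_nonneg (hw0 x) (sub_nonneg.2 (hv1 _))
  -- The calibrated weights are admissible in the definition of the pseudo-Hellinger distance.
  obtain ⟨Y₁, hY₁⟩ := PMF.exists_toReal_eq hwu1 hu1
  obtain ⟨Y₀, hY₀⟩ := PMF.exists_toReal_eq hwu0 hu0
  have hind₁ : Indistinguishable e s ε X₁ Y₁ := fun c hc => by
    refine le_trans (le_of_eq ?_) (hcal c hc)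
    unfold advantage
    congr 1
    refine Finset.sum_congr rfl fun x _ => ?_
    rw [hY₁, mul_comm]
  have hind₀ : Indistinguishable e s ε X₀ Y₀ := fun c hc => by
    refine le_trans (le_of_eq ?_) (hcal c hc)
    unfold advantage
    rw [← abs_neg, ← Finset.sum_neg_distrib]
    congr 1
    refine Finset.sum_congr rfl fun x _ => ?_
    rw [hY₀, show (X₀ x).toReal - w x * (1 - u x) = _ from hneg x]
    ring
  have hδ := h.2 ⟨Y₀, Y₁, hind₀, hind₁, le_rfl⟩
  have hbc : (∑ x, √(w x * u x * (w x * (1 - u x)))) ^ k ≤ Real.exp (-(k * δ ^ 2)) := by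
    have h1 : ∑ x, √(w x * u x * (w x * (1 - u x))) = 1 - hellingerDist Y₀ Y₁ ^ 2 := by
      rw [hellingerDist_sq, sub_sub_cancel]
      refine Finset.sum_congr rfl fun x _ => ?_
      rw [hY₀, hY₁, mul_comm]
    have h2 : ∑ x, √(w x * u x * (w x * (1 - u x))) ≤ Real.exp (-δ ^ 2) := by
      have := pow_le_pow_left₀ h.nonneg hδ 2
      have := Real.add_one_le_exp (-δ ^ 2)
      linarith
    refine (pow_le_pow_left₀ (Finset.sum_nonneg fun x _ => Real.sqrt_nonneg _) h2 k).trans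
      (le_of_eq ?_)
    rw [← Real.exp_nat_mul]
    congr 1
    ring
  obtain ⟨c, hc, hceval⟩ := exists_circuit_sum_nonneg (k := k) (L := 33 * K ^ 2) hS
    (fun a => ratioScore ε (v a)) (fun a => by
      have h1 := abs_ratioScore_le hε hε1 (hv0 a) (hv1 a)
      have h2 : 33 / ε ^ 2 ≤ 33 * (K : ℝ) ^ 2 := by
        rw [div_le_iff₀ (by positivity)]; nlinarith
      have h3 := h1.trans h2
      exact_mod_cast h3)
  refine ⟨c.size, distinguisher_size_le hε hε1 hk hK1 hK2 hc, c, le_rfl, ?_⟩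
  have hF : (fun x => if c.eval (encTuple e k x) then (1 : ℝ) else 0) =
      fun x => if 0 ≤ ∑ i, ratioScore ε (u (x i)) then (1 : ℝ) else 0 := by
    funext x
    rw [hceval]
    simp only [decide_eq_true_eq]
    rfl
  rw [advantage_iidPMF, hF]
  set G : (Fin k → 𝒳) → ℝ := fun x => if 0 ≤ ∑ i, ratioScore ε (u (x i)) then 1 else 0 with hG
  -- The test sees a sample only through `S`, on which `X_b` and its calibrated version agree.
  have hGS : ∀ (i : Fin k) (x : Fin k → 𝒳), ∃ φ : Fin (16 * K ^ 2 + 1) → ℝ,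
      ∀ a, G (Function.update x i a) = φ (S (e a)) := by
    intro i x
    refine ⟨fun b => if 0 ≤ ∑ j, ratioScore ε
      (v (Function.update (fun j => S (e (x j))) i b j)) then 1 else 0, fun a => ?_⟩
    have : ∀ j, u (Function.update x i a j) =
        v (Function.update (fun j => S (e (x j))) i (S (e a)) j) := fun j => by
      by_cases hj : j = i
      · subst hj; simp [u]
      · simp [u, hj]
    simp only [hG, this]
  have t1 : |iidExp p₁ k G - iidExp (fun x => w x * u x) k G| ≤ k * 0 := by
    refine abs_iidExp_sub_le hp₁ hs₁ hwu1 hu1 G fun i x => ?_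
    obtain ⟨φ, hφ⟩ := hGS i x
    simp_rw [hφ]
    rw [hfun, abs_zero]
  have t0 : |iidExp p₀ k G - iidExp (fun x => w x * (1 - u x)) k G| ≤ k * 0 := by
    refine abs_iidExp_sub_le hp₀ hs₀ hwu0 hu0 G fun i x => ?_
    obtain ⟨φ, hφ⟩ := hGS i x
    simp_rw [hφ, hneg, neg_mul]
    rw [Finset.sum_neg_distrib, hfun, neg_zero, abs_zero]
  rw [mul_zero, abs_nonpos_iff, sub_eq_zero] at t0 t1
  have hmain := le_iidExp_ratioScore_test hw0 (fun x => hv0 (S (e x))) (fun x => hv1 (S (e x)))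
    hu1 hu0 hε (k := k) (by linarith)
  change _ ≤ |iidExp p₀ k G - iidExp p₁ k G|
  rw [t0, t1, abs_sub_comm]
  refine le_trans ?_ (hmain.trans (le_abs_self _))
  linarith

/-- A distinguisher for `k` samples works for `l ≥ k` samples, by ignoring the others. -/
theorem Distinguishable.of_le {e : 𝒳 → Fin n → Bool} {s : ℕ} {d : ℝ} {X Y : PMF 𝒳} {k l : ℕ}
    (hkl : k ≤ l) (h : Distinguishable (encTuple e k) s d (iidPMF X k) (iidPMF Y k)) :
    Distinguishable (encTuple e l) s d (iidPMF X l) (iidPMF Y l) := by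
  obtain ⟨c, hc, hd⟩ := h
  obtain ⟨c', hc', hc'e⟩ := c.exists_subst (κ := Fin l × Fin n)
    fun p => .input (Fin.castLE hkl p.1, p.2)
  refine ⟨c', hc'.le.trans hc, hd.trans (le_of_eq ?_)⟩
  have hF : ∀ x : Fin l → 𝒳, c'.eval (encTuple e l x) =
      c.eval (encTuple e k fun i => x (Fin.castLE hkl i)) := fun x => hc'e _
  rw [advantage_iidPMF, advantage_iidPMF]
  simp_rw [hF]
  rw [← iidExp_castLE X.sum_toReal_eq_one _ hkl, ← iidExp_castLE Y.sum_toReal_eq_one _ hkl]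

end Main

theorem theorem1p3 :
    ∃ (C : ℝ) (P : Polynomial ℝ),
      (∀ (𝒳 : Type u) [Fintype 𝒳] (n : ℕ) (enc : 𝒳 ↪ (Fin n → Bool)) (X₀ X₁ : PMF 𝒳)
          (s : ℕ) (ε δ : ℝ), 0 < ε → IsPseudoHellingerDist enc s ε X₀ X₁ δ →
        ∀ k : ℕ,
          Indistinguishable (encTuple enc k) s (Real.sqrt (2 * k * δ ^ 2) + 2 * k * ε)
            (iidPMF X₀ k) (iidPMF X₁ k) ∧
          ∃ s' : ℕ, (s' : ℝ) ≤ C * (s * k / ε ^ 6) + P.eval (k / ε) ∧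
            Distinguishable (encTuple enc k) s' (1 - Real.exp (-(k * δ ^ 2)) - 2 * k * ε)
              (iidPMF X₀ k) (iidPMF X₁ k)) ∧
      (∀ a : ℝ, 0 < a → a < 1 → ∃ c₀ c₁ c₂ : ℝ, 0 < c₀ ∧ 0 < c₁ ∧ 0 < c₂ ∧
        ∀ (𝒳 : Type u) [Fintype 𝒳] (n : ℕ) (enc : 𝒳 ↪ (Fin n → Bool)) (X₀ X₁ : PMF 𝒳)
          (s : ℕ) (ε δ : ℝ), 0 < ε → IsPseudoHellingerDist enc s ε X₀ X₁ δ →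
          (∀ k : ℕ, k * ε ≤ c₀ →
            Distinguishable (encTuple enc k) s a (iidPMF X₀ k) (iidPMF X₁ k) →
              c₁ ≤ k * δ ^ 2) ∧
          (ε ≤ c₀ * δ ^ 2 → ∀ k : ℕ, c₂ ≤ k * δ ^ 2 →
            ∃ s' : ℕ, (s' : ℝ) ≤ C * (s * k / ε ^ 6) + P.eval (k / ε) ∧
              Distinguishable (encTuple enc k) s' a (iidPMF X₀ k) (iidPMF X₁ k))) := by
  refine ⟨20, Polynomial.C 10155456 * Polynomial.X ^ 9, ?_, ?_⟩
  · intro 𝒳 _ n enc X₀ X₁ s ε δ hε h k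
    simp only [Polynomial.eval_mul, Polynomial.eval_C, Polynomial.eval_pow, Polynomial.eval_X]
    exact ⟨h.indistinguishable k, h.distinguishable hε k⟩
  · intro a ha ha1
    -- `exp (-c) ≤ (1 - a) / 2` leaves room `(1 - a) / 2` for the error `2kε` at `kδ² ≤ c + 1`.
    obtain ⟨c, hc, hca⟩ : ∃ c : ℝ, 0 < c ∧ Real.exp (-c) ≤ (1 - a) / 2 := by
      refine ⟨-Real.log ((1 - a) / 2), ?_, ?_⟩
      · exact neg_pos.2 (Real.log_neg (by linarith) (by linarith))
      · rw [neg_neg, Real.exp_log (by linarith)]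
    refine ⟨min (a / 4) ((1 - a) / (4 * (c + 1))), a ^ 2 / 8, c,
      lt_min (by linarith) (div_pos (by linarith) (by linarith)), by positivity, hc, ?_⟩
    intro 𝒳 _ n enc X₀ X₁ s ε δ hε h
    refine ⟨fun k hk hdist => ?_, fun hεδ k hk => ?_⟩
    · obtain ⟨f, hf, hfa⟩ := hdist
      have h1 := hfa.trans (h.indistinguishable k f hf)
      have h2 : k * ε ≤ a / 4 := hk.trans (min_le_left _ _)
      have h3 : a / 2 ≤ √(2 * k * δ ^ 2) := by linarith
      have h4 := (Real.le_sqrt' (by linarith)).1 h3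
      linarith
    · have hδ : 0 < δ ^ 2 := by
        rcases (sq_nonneg δ).eq_or_lt with h0 | h0
        · rw [← h0, mul_zero] at hk; linarith
        · exact h0
      have hδ1 := h.sq_le_one hε
      set l := ⌈c / δ ^ 2⌉₊
      have hlk : l ≤ k := Nat.ceil_le.2 ((div_le_iff₀ hδ).2 hk)
      have hl1 : c ≤ l * δ ^ 2 := (div_le_iff₀ hδ).1 (Nat.le_ceil _)
      have hl2 : l * δ ^ 2 ≤ c + 1 := by
        have h1 := (Nat.ceil_lt_add_one (a := c / δ ^ 2) (by positivity)).le
        have h2 := mul_le_mul_of_nonneg_right h1 hδ.le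
        rw [add_mul, div_mul_cancel₀ _ hδ.ne'] at h2
        linarith
      have hlε : 2 * l * ε ≤ (1 - a) / 2 := by
        have h1 : ε ≤ (1 - a) / (4 * (c + 1)) * δ ^ 2 :=
          hεδ.trans (mul_le_mul_of_nonneg_right (min_le_right _ _) hδ.le)
        have h2 : 0 ≤ (1 - a) / (4 * (c + 1)) := div_nonneg (by linarith) (by linarith)
        calc 2 * l * ε ≤ 2 * l * ((1 - a) / (4 * (c + 1)) * δ ^ 2) := by gcongr
          _ = 2 * ((1 - a) / (4 * (c + 1))) * (l * δ ^ 2) := by ring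
          _ ≤ 2 * ((1 - a) / (4 * (c + 1))) * (c + 1) := by gcongr
          _ = (1 - a) / 2 := by field_simp; ring
      obtain ⟨s', hs', hdist⟩ := h.distinguishable hε l
      refine ⟨s', hs'.trans ?_, ?_⟩
      · simp only [Polynomial.eval_mul, Polynomial.eval_C, Polynomial.eval_pow,
          Polynomial.eval_X]
        gcongr
      · obtain ⟨f, hf, hfa⟩ := hdist.of_le hlk
        refine ⟨f, hf, le_trans ?_ hfa⟩
        have : Real.exp (-(l * δ ^ 2)) ≤ Real.exp (-c) := Real.exp_le_exp.2 (by linarith)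
        linarith
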